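/- A finite graph embedded in the Euclidean plane, whose edges are straight segments that meet each other and the vertices only at common end points (the graph need not be connected), is called a \emph{$3$-regular minimal graph with attaching points $A$} if $A$ is a finite set of vertices of degree $1$, every vertex not in $A$ has degree $3$, and at every vertex of degree greater than $1$ the sum of the unit vectors along the outgoing edges is zero (equivalently, the three edges meet at angles of $120^\circ$). For $n\ge 2$ let $f_3(n)$ be the supremum of the numbers of vertices (attaching points included) of $3$-regular minimal graphs in the plane with exactly $n$ attaching points. \textbf{Theorem.} For every $n\ge 2$ the supremum $f_3(n)$ is finite and attained, and, writing $n=6k+i$ with integers $k\ge 0$ and $0\le i\le 5$, $$f_3(n)=\begin{cases}6k^2+6k & \text{if } n=6k,\\ 6k^2+8k & \text{if } n=6k+1,\\ 6k^2+10k+2 & \text{if } n=6k+2,\\ 6k^2+12k+4 & \text{if } n=6k+3,\\ 6k^2+14k+6 & \text{if } n=6k+4,\\ 6k^2+16k+8 & \text{if } n=6k+5.\end{cases}$$ In particular, $f_3(n)\le \tfrac16 n^2+n$. -/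

import Mathlib

/-- The Euclidean plane. -/
abbrev Plane : Type := EuclideanSpace ℝ (Fin 2)

/-- A finite graph embedded in the plane whose edges are geodesic (that is, straight) segments.
The vertices are points of the plane, and the edge joining two adjacent vertices `u`, `v` is the
segment from `u` to `v`. No vertex lies in the relative interior of an edge, and two distinct
edges have disjoint relative interiors, so edges meet only at common end points. The graph need
not be connected. -/
structure PlaneGraph where
  /-- the vertices -/
  verts : Finset Plane
  /-- adjacency -/
  graph : SimpleGraph Plane
  mem_verts_of_adj : ∀ u v : Plane, graph.Adj u v → u ∈ verts
  vertex_notMem_edge : ∀ u v w : Plane, graph.Adj u v → w ∈ verts → w ∉ openSegment ℝ u v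
  edges_disjoint : ∀ u v x y : Plane, graph.Adj u v → graph.Adj x y → s(u, v) ≠ s(x, y) →
    Disjoint (openSegment ℝ u v) (openSegment ℝ x y)

namespace PlaneGraph

open Classical in
/-- The set of neighbours of a point `v`. -/
noncomputable def neighbors (G : PlaneGraph) (v : Plane) : Finset Plane :=
  {w ∈ G.verts | G.graph.Adj v w}

/-- The degree of a vertex. -/
noncomputable def degree (G : PlaneGraph) (v : Plane) : ℕ := (G.neighbors v).card

/-- `G` is a minimal graph with set of attaching points `A`: every attaching point is a vertex of
degree `1`, and at each vertex of degree greater than `1` the unit vectors of the outgoing edges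
sum to zero. -/
structure IsMinimal (G : PlaneGraph) (A : Finset Plane) : Prop where
  subset_verts : A ⊆ G.verts
  degree_eq_one : ∀ a ∈ A, G.degree a = 1
  balanced : ∀ v ∈ G.verts, 1 < G.degree v →
    ∑ w ∈ G.neighbors v, ‖w - v‖⁻¹ • (w - v) = 0

/-- `G` is `d`-regular relative to the attaching points `A`: every vertex which is not an
attaching point has degree `d`. -/
def IsRegularOff (G : PlaneGraph) (d : ℕ) (A : Finset Plane) : Prop :=
  ∀ v ∈ G.verts, v ∉ A → G.degree v = d

/-- The numbers of vertices (attaching points included) of the `3`-regular minimal graphs in the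
plane with exactly `n` attaching points. -/
def vertexCounts (n : ℕ) : Set ℕ :=
  {m | ∃ (G : PlaneGraph) (A : Finset Plane),
    G.IsMinimal A ∧ G.IsRegularOff 3 A ∧ A.card = n ∧ G.verts.card = m}

/-- The supremum of the numbers of vertices of the `3`-regular minimal graphs in the plane with
`n` attaching points, as an extended natural number. -/
noncomputable def f3 (n : ℕ) : ℕ∞ := ⨆ m ∈ vertexCounts n, (m : ℕ∞)

end PlaneGraph

/-! Let N be the number of vertices of degree 3. Counting edge ends shows that 3N + n is even, so N
+ n is even. It remains to prove 6N ≤ n² and to find graphs in which N is the largest integer that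
both conditions allow.

Upper bound. Three unit vectors with zero sum have the same cube, and reversing an edge changes only
the sign of its direction; hence the sixth power of the direction is constant on each component.
Since a sum of squares is at most the square of the sum, the parts belonging to different sixth
powers can be treated separately, and after a rotation all edges point along powers of ω =
exp(πi/3). Every horizontal edge lies on one rising zigzag (directions 1 and ω) and on one falling
zigzag (directions 1 and ω⁻¹). Two such zigzags share at most one horizontal edge, because beyond it
one rises and the other falls. Zigzags start at leaves, so the horizontal edges are bounded by a
product of two leaf counts. There is a correction: if both zigzags start with horizontal edges, at
different leaves, they can share one only when the rising zigzag starts lower, so at least half of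
these pairs are wasted; the same holds at the ends (`ZigzagPair.two_mul_card_tails_le`).

Let a_j count the leaves whose edge has direction ω^j, and put x = a₀ + a₃, y = a₁ + a₄, z = a₂ +
a₅. The correction makes the estimate symmetric: N ≤ (xy + yz + zx - δ²)/2, where δ = a₃ - a₀ is
also the difference between the numbers of the two kinds of interior vertices. The right side is at
most (x + y + z)²/6 (`HexGraph.six_mul_card_interior_le`).

Lower bound. Two consecutive layers of ℤ³, projected along the diagonal, form a honeycomb. A p × q ×
r box cuts out a hexagonal piece with p + q + r leaves (`HexBox.card_outer`, `HexBox.card_inner`).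
Nearly equal sides and a layer in the middle reach the bound; n = 2 is a single edge. -/

/-! ### Orbits of monotone maps on finite sets -/

/-- Iterating a map that strictly increases a function unless it stays in place ends at a fixed
point. -/
theorem exists_iterate_fixed {V : Type*} [Finite V] (f : V → V) (X : V → ℝ)
    (hX : ∀ v, f v ≠ v → X v < X (f v)) (v : V) : ∃ k, f (f^[k] v) = f^[k] v := by
  by_contra! h
  have hmono : StrictMono fun k => X (f^[k] v) := by
    refine strictMono_nat_of_lt_succ fun k => ?_
    rw [Function.iterate_succ_apply']
    exact hX _ (h k)
  have hinj : Function.Injective fun k => f^[k] v := fun i j hij =>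
    hmono.injective (congrArg X hij)
  exact not_injective_infinite_finite _ hinj

theorem exists_iterate_of_iterate_inverse {V : Type*} {f f' : V → V}
    (hf : ∀ v, f' v ≠ v → f (f' v) = v) {v s : V} {k : ℕ} (h : f'^[k] v = s) :
    ∃ i, f^[i] s = v := by
  induction k generalizing v with
  | zero => exact ⟨0, h.symm⟩
  | succ k ih =>
    rw [Function.iterate_succ_apply] at h
    obtain ⟨i, hi⟩ := ih h
    by_cases hv : f' v = v
    · exact ⟨i, hi.trans hv⟩
    · exact ⟨i + 1, by rw [Function.iterate_succ_apply', hi, hf v hv]⟩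

theorem iterate_comparable {V : Type*} {f : V → V} {s u u' : V} {i j : ℕ}
    (h : f^[i] s = u) (h' : f^[j] s = u') : (∃ k, f^[k] u = u') ∨ ∃ k, f^[k] u' = u := by
  rcases le_total i j with hij | hij
  · left
    refine ⟨j - i, ?_⟩
    rw [← h, ← Function.iterate_add_apply, Nat.sub_add_cancel hij, h']
  · right
    refine ⟨i - j, ?_⟩
    rw [← h', ← Function.iterate_add_apply, Nat.sub_add_cancel hij, h]

/-- Of `(a, b)` and `(b, a)` at least one is counted, even when the heights tie. This yields the
quadratic correction terms in the main count. -/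
theorem card_mul_card_le_two_mul_card_ordered {V : Type*} [DecidableEq V] (S : Finset V)
    (H : V → ℝ) :
    S.card * S.card ≤
      2 * ((S ×ˢ S).filter fun p => p.1 ≠ p.2 ∧ H p.2 ≤ H p.1).card + S.card := by
  set M := (S ×ˢ S).filter fun p => p.1 ≠ p.2 ∧ H p.2 ≤ H p.1
  have hsub : S.offDiag ⊆ M ∪ M.image Prod.swap := by
    rintro ⟨a, b⟩ hab
    rw [Finset.mem_offDiag] at hab
    simp only [Finset.mem_union, Finset.mem_image, M, Finset.mem_filter, Finset.mem_product]
    rcases le_total (H b) (H a) with h | h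
    · exact Or.inl ⟨⟨hab.1, hab.2.1⟩, hab.2.2, h⟩
    · exact Or.inr ⟨(b, a), ⟨⟨hab.2.1, hab.1⟩, hab.2.2.symm, h⟩, rfl⟩
  have h1 := (Finset.card_le_card hsub).trans (Finset.card_union_le _ _)
  have h2 : (M.image Prod.swap).card ≤ M.card := Finset.card_image_le
  rw [Finset.offDiag_card] at h1
  omega

/-! ### Abstract zigzags and the main count -/

/-- Two families of zigzags on a set of points: the steps of the first family go to the right,
horizontally or upwards, those of the second family go to the right, horizontally or downwards,
and horizontal steps belong to both. A zigzag stops at a point which its step does not move. The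
sets `tails` and `heads` hold the left and right end points of the horizontal steps. -/
structure ZigzagPair (V : Type*) where
  (up upInv down downInv : V → V)
  (abscissa height : V → ℝ)
  (tails heads : V → Prop)
  upInv_up : ∀ v, up v ≠ v → upInv (up v) = v
  up_upInv : ∀ v, upInv v ≠ v → up (upInv v) = v
  downInv_down : ∀ v, down v ≠ v → downInv (down v) = v
  down_downInv : ∀ v, downInv v ≠ v → down (downInv v) = v
  abscissa_up : ∀ v, up v ≠ v → abscissa v < abscissa (up v)
  abscissa_down : ∀ v, down v ≠ v → abscissa v < abscissa (down v)
  up_ne : ∀ v, tails v → up v ≠ v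
  down_eq_up : ∀ v, tails v → down v = up v
  height_eq : ∀ v, tails v → height (up v) = height v
  heads_up : ∀ v, tails v → heads (up v)
  upInv_ne : ∀ v, heads v → upInv v ≠ v
  downInv_eq_upInv : ∀ v, heads v → downInv v = upInv v
  tails_upInv : ∀ v, heads v → tails (upInv v)
  height_up : ∀ v, ¬ tails v → up v ≠ v → height v < height (up v)
  height_down : ∀ v, ¬ tails v → down v ≠ v → height (down v) < height v
  not_heads : ∀ v, tails v → ¬ heads v

namespace ZigzagPair

variable {V : Type*} (Z : ZigzagPair V)

/-- The rotation of a pair of zigzag families by a half turn. -/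
def reverse : ZigzagPair V where
  up := Z.upInv
  upInv := Z.up
  down := Z.downInv
  downInv := Z.down
  abscissa := fun v => - Z.abscissa v
  height := fun v => - Z.height v
  tails := Z.heads
  heads := Z.tails
  upInv_up := Z.up_upInv
  up_upInv := Z.upInv_up
  downInv_down := Z.down_downInv
  down_downInv := Z.downInv_down
  abscissa_up := fun v hv => by
    have h := Z.up_upInv v hv
    have := Z.abscissa_up (Z.upInv v) (by rw [h]; exact hv.symm)
    rw [h] at this
    linarith
  abscissa_down := fun v hv => by
    have h := Z.down_downInv v hv
    have := Z.abscissa_down (Z.downInv v) (by rw [h]; exact hv.symm)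
    rw [h] at this
    linarith
  up_ne := Z.upInv_ne
  down_eq_up := Z.downInv_eq_upInv
  height_eq := fun v hv => by
    have := Z.height_eq _ (Z.tails_upInv v hv)
    rw [Z.up_upInv v (Z.upInv_ne v hv)] at this
    rw [this]
  heads_up := Z.tails_upInv
  upInv_ne := Z.up_ne
  downInv_eq_upInv := Z.down_eq_up
  tails_upInv := Z.heads_up
  height_up := fun v hv hne => by
    have h := Z.up_upInv v hne
    have := Z.height_up (Z.upInv v) (fun ht => hv (h ▸ Z.heads_up _ ht))
      (by rw [h]; exact hne.symm)
    rw [h] at this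
    linarith
  height_down := fun v hv hne => by
    have h := Z.down_downInv v hne
    have := Z.height_down (Z.downInv v)
      (fun ht => hv (by
        have h1 := Z.heads_up _ ht
        rwa [← Z.down_eq_up _ ht, h] at h1))
      (by rw [h]; exact hne.symm)
    rw [h] at this
    linarith
  not_heads := fun v hv ht => Z.not_heads v ht hv

theorem height_le_up (v : V) : Z.height v ≤ Z.height (Z.up v) := by
  by_cases ht : Z.tails v
  · exact (Z.height_eq v ht).ge
  · by_cases h : Z.up v = v
    · rw [h]
    · exact (Z.height_up v ht h).le

theorem height_down_le (v : V) : Z.height (Z.down v) ≤ Z.height v := by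
  by_cases ht : Z.tails v
  · rw [Z.down_eq_up v ht]; exact (Z.height_eq v ht).le
  · by_cases h : Z.down v = v
    · rw [h]
    · exact (Z.height_down v ht h).le

theorem height_le_iterate_up (v : V) (k : ℕ) : Z.height v ≤ Z.height (Z.up^[k] v) := by
  induction k with
  | zero => exact le_rfl
  | succ k ih =>
    rw [Function.iterate_succ_apply']
    exact ih.trans (Z.height_le_up _)

theorem height_iterate_down_le (v : V) (k : ℕ) : Z.height (Z.down^[k] v) ≤ Z.height v := by
  induction k with
  | zero => exact le_rfl
  | succ k ih =>
    rw [Function.iterate_succ_apply']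
    exact (Z.height_down_le _).trans ih

theorem abscissa_iterate_up (v : V) (k : ℕ) :
    Z.up^[k] v = v ∨ Z.abscissa v < Z.abscissa (Z.up^[k] v) := by
  induction k with
  | zero => exact Or.inl rfl
  | succ k ih =>
    rw [Function.iterate_succ_apply']
    by_cases h : Z.up (Z.up^[k] v) = Z.up^[k] v
    · rwa [h]
    · have := Z.abscissa_up _ h
      rcases ih with ih | ih
      · rw [ih] at this ⊢; exact Or.inr this
      · exact Or.inr (ih.trans this)

theorem abscissa_iterate_down (v : V) (k : ℕ) :
    Z.down^[k] v = v ∨ Z.abscissa v < Z.abscissa (Z.down^[k] v) := by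
  induction k with
  | zero => exact Or.inl rfl
  | succ k ih =>
    rw [Function.iterate_succ_apply']
    by_cases h : Z.down (Z.down^[k] v) = Z.down^[k] v
    · rwa [h]
    · have := Z.abscissa_down _ h
      rcases ih with ih | ih
      · rw [ih] at this ⊢; exact Or.inr this
      · exact Or.inr (ih.trans this)

/-- Two horizontal steps never follow each other. The second step, if there is one, therefore rises
strictly, and no later step descends. -/
theorem iterate_up_of_tails {u : V} (hu : Z.tails u) (k : ℕ) :
    Z.up^[k] u = u ∨ Z.up^[k] u = Z.up u ∨ Z.height u < Z.height (Z.up^[k] u) := by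
  match k with
  | 0 => exact Or.inl rfl
  | 1 => exact Or.inr (Or.inl rfl)
  | k + 2 =>
    right
    rw [Function.iterate_succ_apply, Function.iterate_succ_apply]
    by_cases h : Z.up (Z.up u) = Z.up u
    · left
      rw [h, Function.iterate_fixed h]
    · right
      have h1 := Z.height_up (Z.up u) (fun ht => Z.not_heads _ ht (Z.heads_up u hu)) h
      rw [Z.height_eq u hu] at h1
      exact h1.trans_le (Z.height_le_iterate_up _ _)

theorem iterate_down_of_tails {u : V} (hu : Z.tails u) (k : ℕ) :
    Z.down^[k] u = u ∨ Z.down^[k] u = Z.up u ∨ Z.height (Z.down^[k] u) < Z.height u := by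
  match k with
  | 0 => exact Or.inl rfl
  | 1 => exact Or.inr (Or.inl (Z.down_eq_up u hu))
  | k + 2 =>
    right
    rw [Function.iterate_succ_apply, Function.iterate_succ_apply, Z.down_eq_up u hu]
    by_cases h : Z.down (Z.up u) = Z.up u
    · left
      rw [h, Function.iterate_fixed h]
    · right
      have h1 := Z.height_down (Z.up u) (fun ht => Z.not_heads _ ht (Z.heads_up u hu)) h
      rw [Z.height_eq u hu] at h1
      exact (Z.height_iterate_down_le _ _).trans_lt h1

theorem not_tails_up {u : V} (hu : Z.tails u) : ¬ Z.tails (Z.up u) := fun h =>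
  Z.not_heads _ h (Z.heads_up u hu)

theorem eq_or_height_lt_of_up {u w : V} (hu : Z.tails u) (hw : Z.tails w) {k : ℕ}
    (h : Z.up^[k] u = w) : u = w ∨ Z.height u < Z.height w := by
  rcases Z.iterate_up_of_tails hu k with h1 | h1 | h1
  · exact Or.inl (h1.symm.trans h)
  · exact absurd (h1 ▸ h ▸ hw) (Z.not_tails_up hu)
  · exact Or.inr (h ▸ h1)

theorem eq_or_height_lt_of_down {u w : V} (hu : Z.tails u) (hw : Z.tails w) {k : ℕ}
    (h : Z.down^[k] u = w) : u = w ∨ Z.height w < Z.height u := by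
  rcases Z.iterate_down_of_tails hu k with h1 | h1 | h1
  · exact Or.inl (h1.symm.trans h)
  · exact absurd (h1 ▸ h ▸ hw) (Z.not_tails_up hu)
  · exact Or.inr (h ▸ h1)

/-- Zigzags of the two families which start at different horizontal steps and have a common
horizontal step start at different heights. -/
theorem eq_or_height_lt_of_meet {s s' u : V} (hs : Z.tails s) (hs' : Z.tails s')
    (hu : Z.tails u) {i j : ℕ} (hi : Z.up^[i] s = u) (hj : Z.down^[j] s' = u) :
    s = s' ∨ Z.height s < Z.height s' := by
  rcases Z.eq_or_height_lt_of_up hs hu hi with h | h <;>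
  rcases Z.eq_or_height_lt_of_down hs' hu hj with h' | h'
  · exact Or.inl (h.trans h'.symm)
  · exact Or.inr (h ▸ h')
  · exact Or.inr (h' ▸ h)
  · exact Or.inr (h.trans h')

/-- Zigzags of the two families have at most one horizontal step in common. -/
theorem eq_of_up_of_down {u u' : V} (hu : Z.tails u) (hu' : Z.tails u') {k : ℕ}
    (hk : Z.up^[k] u = u')
    (h : (∃ m, Z.down^[m] u = u') ∨ ∃ m, Z.down^[m] u' = u) : u = u' := by
  -- If both zigzags lead from `u` to `u'`, the heights conflict; if they lead in opposite senses,
  -- the abscissas do.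
  rcases h with ⟨m, hm⟩ | ⟨m, hm⟩
  · rcases Z.eq_or_height_lt_of_up hu hu' hk with h | h
    · exact h
    · exact absurd (hm ▸ Z.height_iterate_down_le u m) (not_le.mpr h)
  · rcases Z.abscissa_iterate_up u k with h | h
    · exact h.symm.trans hk
    · rcases Z.abscissa_iterate_down u' m with h' | h'
      · exact hm.symm.trans h'
      · rw [hk] at h; rw [hm] at h'
        exact absurd h (not_lt.mpr h'.le)

variable [Finite V]

theorem exists_upStart (v : V) :
    ∃ s, Z.upInv s = s ∧ (∃ k, Z.upInv^[k] v = s) ∧ ∃ i, Z.up^[i] s = v := by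
  obtain ⟨k, hk⟩ := exists_iterate_fixed Z.upInv Z.reverse.abscissa Z.reverse.abscissa_up v
  exact ⟨_, hk, ⟨k, rfl⟩, exists_iterate_of_iterate_inverse Z.up_upInv rfl⟩

theorem exists_downStart (v : V) :
    ∃ s, Z.downInv s = s ∧ (∃ k, Z.downInv^[k] v = s) ∧ ∃ i, Z.down^[i] s = v := by
  obtain ⟨k, hk⟩ := exists_iterate_fixed Z.downInv Z.reverse.abscissa Z.reverse.abscissa_down v
  exact ⟨_, hk, ⟨k, rfl⟩, exists_iterate_of_iterate_inverse Z.down_downInv rfl⟩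

open Classical in
/-- The main count: the pairs consisting of a zigzag of each family outnumber the horizontal steps
by at least the number of pairs of points where zigzags of both families start with a horizontal
step, plus the number of pairs of points where zigzags of both families end with one. -/
theorem two_mul_card_tails_le [Fintype V]
    (hiso : ∀ v, Z.tails v → Z.upInv v = v → Z.downInv v = v → Z.up (Z.up v) ≠ Z.up v)
    (D A B S E : Finset V)
    (hD : ∀ v, v ∈ D ↔ Z.tails v)
    (hA : ∀ v, v ∈ A ↔ Z.upInv v = v ∧ Z.up v ≠ v)
    (hB : ∀ v, v ∈ B ↔ Z.downInv v = v ∧ Z.down v ≠ v)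
    (hS : ∀ v, v ∈ S ↔ Z.tails v ∧ Z.upInv v = v ∧ Z.downInv v = v)
    (hE : ∀ v, v ∈ E ↔ Z.heads v ∧ Z.up v = v ∧ Z.down v = v) :
    2 * D.card + S.card * S.card + E.card * E.card
      ≤ 2 * (A.card * B.card) + S.card + E.card := by
  choose a ha_fix ha_back ha using Z.exists_upStart
  choose b hb_fix hb_back hb using Z.exists_downStart
  -- `M` and `N` hold pairs of starts and of ends whose order of heights prevents the two zigzags
  -- from sharing a horizontal step. With the pairs that do share one, they give three disjoint
  -- families inside `A ×ˢ B`.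
  set M := (S ×ˢ S).filter fun p => p.1 ≠ p.2 ∧ Z.height p.2 ≤ Z.height p.1 with hM
  set N := (E ×ˢ E).filter fun p => p.1 ≠ p.2 ∧ - Z.height p.2 ≤ - Z.height p.1 with hN
  have hMcard : S.card * S.card ≤ 2 * M.card + S.card :=
    card_mul_card_le_two_mul_card_ordered S Z.height
  have hNcard : E.card * E.card ≤ 2 * N.card + E.card :=
    card_mul_card_le_two_mul_card_ordered E (fun v => - Z.height v)
  let φ : V → V × V := fun u => (a u, b u)
  let ψ : V × V → V × V := fun p => (a p.1, b p.2)
  have up_mem : ∀ v w : V, (∃ k, Z.up^[k] v = w) → Z.upInv v = v → (Z.up w ≠ w ∨ Z.upInv w ≠ w) →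
      v ∈ A := by
    rintro v w ⟨k, hk⟩ hv hw
    refine (hA v).mpr ⟨hv, fun h => ?_⟩
    rw [Function.iterate_fixed h] at hk
    subst hk
    tauto
  have down_mem : ∀ v w : V, (∃ k, Z.down^[k] v = w) → Z.downInv v = v →
      (Z.down w ≠ w ∨ Z.downInv w ≠ w) → v ∈ B := by
    rintro v w ⟨k, hk⟩ hv hw
    refine (hB v).mpr ⟨hv, fun h => ?_⟩
    rw [Function.iterate_fixed h] at hk
    subst hk
    tauto
  have a_comp : ∀ u u', a u = a u' → (∃ k, Z.up^[k] u = u') ∨ ∃ k, Z.up^[k] u' = u := by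
    intro u u' h
    obtain ⟨i, hi⟩ := ha u
    obtain ⟨j, hj⟩ := ha u'
    rw [← h] at hj
    exact iterate_comparable hi hj
  have b_comp : ∀ u u', b u = b u' → (∃ k, Z.down^[k] u = u') ∨ ∃ k, Z.down^[k] u' = u := by
    intro u u' h
    obtain ⟨i, hi⟩ := hb u
    obtain ⟨j, hj⟩ := hb u'
    rw [← h] at hj
    exact iterate_comparable hi hj
  have hφ_inj : Set.InjOn φ D := by
    intro u hu u' hu' h
    have hu := (hD u).mp hu
    have hu' := (hD u').mp hu'
    have h1 : a u = a u' := congrArg Prod.fst h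
    have h2 : b u = b u' := congrArg Prod.snd h
    rcases a_comp u u' h1 with ⟨k, hk⟩ | ⟨k, hk⟩
    · exact Z.eq_of_up_of_down hu hu' hk (b_comp u u' h2)
    · exact (Z.eq_of_up_of_down hu' hu hk (b_comp u' u h2.symm)).symm
  -- A zigzag stops at one point only, so its start determines its end.
  have hψ_inj : Set.InjOn ψ N := by
    rintro ⟨e, e'⟩ he ⟨d, d'⟩ hd h
    simp only [hN, Finset.coe_filter, Finset.mem_product, Set.mem_ofPred_eq, hE] at he hd
    have h1 : a e = a d := congrArg Prod.fst h
    have h2 : b e' = b d' := congrArg Prod.snd h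
    have h3 : e = d := by
      rcases a_comp e d h1 with ⟨k, hk⟩ | ⟨k, hk⟩
      · rwa [Function.iterate_fixed he.1.1.2.1] at hk
      · rw [Function.iterate_fixed hd.1.1.2.1] at hk; exact hk.symm
    have h4 : e' = d' := by
      rcases b_comp e' d' h2 with ⟨k, hk⟩ | ⟨k, hk⟩
      · rwa [Function.iterate_fixed he.1.2.2.2] at hk
      · rw [Function.iterate_fixed hd.1.2.2.2] at hk; exact hk.symm
    rw [h3, h4]
  have hφM : Disjoint (D.image φ) M := by
    rw [Finset.disjoint_left]
    rintro p hp hpM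
    obtain ⟨u, hu, rfl⟩ := Finset.mem_image.mp hp
    simp only [hM, Finset.mem_filter, Finset.mem_product, hS, φ] at hpM
    obtain ⟨⟨h1, h2⟩, hne, hle⟩ := hpM
    obtain ⟨i, hi⟩ := ha u
    obtain ⟨j, hj⟩ := hb u
    rcases Z.eq_or_height_lt_of_meet h1.1 h2.1 ((hD u).mp hu) hi hj with h | h
    · exact hne h
    · exact absurd hle (not_le.mpr h)
  have hφN : Disjoint (D.image φ) (N.image ψ) := by
    rw [Finset.disjoint_left]
    rintro p hp hpN
    obtain ⟨u, hu, rfl⟩ := Finset.mem_image.mp hp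
    obtain ⟨⟨e, e'⟩, he, h⟩ := Finset.mem_image.mp hpN
    simp only [hN, Finset.mem_filter, Finset.mem_product, hE] at he
    obtain ⟨⟨h1, h2⟩, hne, hle⟩ := he
    have hu := (hD u).mp hu
    have h3 : a e = a u := congrArg Prod.fst h
    have h4 : b e' = b u := congrArg Prod.snd h
    -- Followed backwards from its end, the zigzag meets the right end of the common step, which is
    -- a horizontal step of the reversed pair. There `e` and `e'` are starts, and the estimate for
    -- starts applies.
    have h5 : ∃ i, Z.upInv^[i] e = Z.up u := by
      rcases a_comp e u h3 with ⟨k, hk⟩ | ⟨k, hk⟩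
      · rw [Function.iterate_fixed h1.2.1] at hk
        subst hk
        exact absurd h1.2.1 (Z.up_ne _ hu)
      · cases k with
        | zero =>
          subst hk
          exact absurd h1.2.1 (Z.up_ne _ hu)
        | succ k => exact exists_iterate_of_iterate_inverse Z.upInv_up hk
    have h6 : ∃ i, Z.downInv^[i] e' = Z.up u := by
      have hd : Z.down u ≠ u := by rw [Z.down_eq_up u hu]; exact Z.up_ne _ hu
      rcases b_comp e' u h4 with ⟨k, hk⟩ | ⟨k, hk⟩
      · rw [Function.iterate_fixed h2.2.2] at hk
        subst hk
        exact absurd h2.2.2 hd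
      · cases k with
        | zero =>
          subst hk
          exact absurd h2.2.2 hd
        | succ k =>
          rw [← Z.down_eq_up u hu]
          exact exists_iterate_of_iterate_inverse Z.downInv_down hk
    obtain ⟨i, hi⟩ := h5
    obtain ⟨j, hj⟩ := h6
    rcases Z.reverse.eq_or_height_lt_of_meet h1.1 h2.1 (Z.heads_up u hu) hi hj with h | h
    · exact hne h
    · exact absurd hle (not_le.mpr h)
  -- A pair of both kinds would give height e ≤ height e' ≤ height (b e') ≤ height (a e) < height e.
  -- The last inequality is strict because `hiso` forbids the rising zigzag to stop after its first,
  -- horizontal step.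
  have hMN : Disjoint M (N.image ψ) := by
    rw [Finset.disjoint_left]
    rintro p hpM hpN
    obtain ⟨⟨e, e'⟩, he, rfl⟩ := Finset.mem_image.mp hpN
    simp only [hN, Finset.mem_filter, Finset.mem_product, hE] at he
    simp only [hM, Finset.mem_filter, Finset.mem_product, hS, ψ] at hpM
    obtain ⟨⟨h1, h2⟩, -, hle⟩ := hpM
    obtain ⟨i, hi⟩ := ha e
    obtain ⟨j, hj⟩ := hb e'
    have h3 := Z.height_iterate_down_le (b e') j
    rw [hj] at h3
    have h4 : Z.height (a e) < Z.height e := by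
      rcases Z.iterate_up_of_tails h1.1 i with h | h | h
      · exact absurd (by rw [h.symm.trans hi]; exact he.1.1.2.1) (Z.up_ne _ h1.1)
      · have := hiso _ h1.1 h1.2.1 h1.2.2
        rw [← h, hi] at this
        exact absurd he.1.1.2.1 this
      · rwa [hi] at h
    linarith [he.2.2]
  have hsub : D.image φ ∪ M ∪ N.image ψ ⊆ A ×ˢ B := by
    intro p hp
    rw [Finset.mem_union, Finset.mem_union] at hp
    rw [Finset.mem_product]
    rcases hp with (hp | hp) | hp
    · obtain ⟨u, hu, rfl⟩ := Finset.mem_image.mp hp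
      have hu := (hD u).mp hu
      exact ⟨up_mem _ u (ha u) (ha_fix u) (Or.inl (Z.up_ne u hu)),
        down_mem _ u (hb u) (hb_fix u)
          (Or.inl (by rw [Z.down_eq_up u hu]; exact Z.up_ne u hu))⟩
    · simp only [hM, Finset.mem_filter, Finset.mem_product, hS] at hp
      refine ⟨(hA _).mpr ⟨hp.1.1.2.1, Z.up_ne _ hp.1.1.1⟩, (hB _).mpr ⟨hp.1.2.2.2, ?_⟩⟩
      rw [Z.down_eq_up _ hp.1.2.1]
      exact Z.up_ne _ hp.1.2.1
    · obtain ⟨⟨e, e'⟩, he, rfl⟩ := Finset.mem_image.mp hp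
      simp only [hN, Finset.mem_filter, Finset.mem_product, hE] at he
      refine ⟨up_mem _ e (ha e) (ha_fix e) (Or.inr (Z.upInv_ne _ he.1.1.1)),
        down_mem _ e' (hb e') (hb_fix e') (Or.inr ?_)⟩
      rw [Z.downInv_eq_upInv _ he.1.2.1]
      exact Z.upInv_ne _ he.1.2.1
  have hcard := Finset.card_le_card hsub
  rw [Finset.card_union_of_disjoint (Finset.disjoint_union_left.mpr ⟨hφN, hMN⟩),
    Finset.card_union_of_disjoint hφM, Finset.card_image_of_injOn hφ_inj,
    Finset.card_image_of_injOn hψ_inj, Finset.card_product] at hcard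
  omega

end ZigzagPair

/-! ### Sixth roots of unity -/

/-- The primitive sixth root of unity `exp (π i / 3)`. -/
noncomputable def sixthRoot : ℂ := ⟨1 / 2, √3 / 2⟩

theorem sixthRoot_sq : sixthRoot ^ 2 = sixthRoot - 1 := by
  have h : √3 * √3 = 3 := Real.mul_self_sqrt (by norm_num)
  rw [sq]
  apply Complex.ext
  · simp only [sixthRoot, Complex.mul_re, Complex.sub_re, Complex.one_re]
    linarith
  · simp only [sixthRoot, Complex.mul_im, Complex.sub_im, Complex.one_im]
    ring

theorem sixthRoot_cube : sixthRoot ^ 3 = -1 := by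
  have h := sixthRoot_sq
  linear_combination (sixthRoot + 1) * h

theorem sixthRoot_pow_four : sixthRoot ^ 4 = -sixthRoot := by
  linear_combination sixthRoot * sixthRoot_cube

theorem sixthRoot_pow_five : sixthRoot ^ 5 = 1 - sixthRoot := by
  linear_combination sixthRoot ^ 2 * sixthRoot_cube - sixthRoot_sq

theorem sixthRoot_im_pos : 0 < sixthRoot.im := by
  simp only [sixthRoot]
  positivity

theorem isPrimitiveRoot_sixthRoot : IsPrimitiveRoot sixthRoot 6 := by
  have him := sixthRoot_im_pos
  refine IsPrimitiveRoot.mk_of_lt _ (by norm_num) ?_ ?_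
  · linear_combination (sixthRoot ^ 3 - 1) * sixthRoot_cube
  · intro l h0 h6 h
    have h' := congrArg Complex.im h
    have h'' := congrArg Complex.re h
    interval_cases l
    · simp at h'; linarith
    · rw [sixthRoot_sq] at h'; simp at h'; linarith
    · rw [sixthRoot_cube] at h''; norm_num at h''
    · rw [sixthRoot_pow_four] at h'; simp at h'; linarith
    · rw [sixthRoot_pow_five] at h'; simp at h'; linarith

theorem cube_one_sub_sixthRoot : (1 - sixthRoot) ^ 3 = -1 := by
  have h := sixthRoot_sq
  linear_combination (-sixthRoot + 2) * h

/-! ### Graphs with edges along the sixth roots of unity -/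

/-- A graph with positions in the complex plane whose edges are segments in the directions of the
sixth roots of unity, where a vertex either is an interior vertex, with three edges in directions
with the same cube, or is adjacent to just one vertex, an interior one. -/
structure HexGraph (V : Type*) where
  adj : V → V → Prop
  pos : V → ℂ
  dir : V → V → ℂ
  interior : V → Prop
  symm : ∀ {v w}, adj v w → adj w v
  dir_swap : ∀ {v w}, adj v w → dir w v = - dir v w
  pos_eq : ∀ {v w}, adj v w → ∃ r : ℝ, 0 < r ∧ pos w = pos v + r * dir v w
  dir_six : ∀ {v w}, adj v w → dir v w ^ 6 = 1
  dir_cube : ∀ {v w w'}, adj v w → adj v w' → dir v w ^ 3 = dir v w' ^ 3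
  dir_inj : ∀ {v w w'}, adj v w → adj v w' → dir v w = dir v w' → w = w'
  exists_adj : ∀ v, ∃ w, adj v w
  full : ∀ {v w d}, interior v → adj v w → d ^ 3 = dir v w ^ 3 → ∃ w', adj v w' ∧ dir v w' = d
  leaf : ∀ {v w w'}, ¬ interior v → adj v w → adj v w' → w = w'
  interior_of_adj : ∀ {v w}, adj v w → interior v ∨ interior w

namespace HexGraph

variable {V : Type*} (K : HexGraph V)

/-- There is an edge at `v` in the direction `d`. -/
def HasDir (v : V) (d : ℂ) : Prop := ∃ w, K.adj v w ∧ K.dir v w = d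

open Classical in
/-- The step from `v` along an edge in one of the directions `a`, `b`, if there is one. -/
noncomputable def step (a b : ℂ) (v : V) : V :=
  if h : ∃ w, K.adj v w ∧ (K.dir v w = a ∨ K.dir v w = b) then h.choose else v

theorem ne_of_adj {v w : V} (h : K.adj v w) : w ≠ v := by
  rintro rfl
  obtain ⟨r, hr, hw⟩ := K.pos_eq h
  have h6 := K.dir_six h
  have : (r : ℂ) * K.dir w w = 0 := by linear_combination -hw
  rcases mul_eq_zero.mp this with h0 | h0
  · exact hr.ne' (by exact_mod_cast h0)
  · rw [h0] at h6; norm_num at h6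

/-- All directions at a vertex have the same cube, so at most one of two directions with different
cubes occurs there and the choice in `step` is forced. The case `a = b` serves for counting the
edges in a single direction. -/
theorem step_eq {a b : ℂ} (hab : a = b ∨ a ^ 3 ≠ b ^ 3) {v w : V} (h : K.adj v w)
    (hd : K.dir v w = a ∨ K.dir v w = b) : K.step a b v = w := by
  have hex : ∃ w, K.adj v w ∧ (K.dir v w = a ∨ K.dir v w = b) := ⟨w, h, hd⟩
  rw [step, dif_pos hex]
  obtain ⟨h1, h2⟩ := hex.choose_spec
  have hc := K.dir_cube h h1
  refine K.dir_inj h1 h ?_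
  rcases hab with rfl | hab
  · rw [hd.elim id id]
    exact h2.elim id id
  · rcases hd with hd | hd <;> rcases h2 with h2 | h2 <;> rw [hd, h2] at hc <;> rw [hd, h2]
    · exact absurd hc hab
    · exact absurd hc.symm hab

theorem step_spec {a b : ℂ} {v : V} (h : K.step a b v ≠ v) :
    K.adj v (K.step a b v) ∧ (K.dir v (K.step a b v) = a ∨ K.dir v (K.step a b v) = b) := by
  by_cases hex : ∃ w, K.adj v w ∧ (K.dir v w = a ∨ K.dir v w = b)
  · have := hex.choose_spec
    rw [step, dif_pos hex]
    exact this
  · rw [step, dif_neg hex] at h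
    exact absurd rfl h

theorem step_ne_iff {a b : ℂ} (hab : a = b ∨ a ^ 3 ≠ b ^ 3) {v : V} :
    K.step a b v ≠ v ↔ K.HasDir v a ∨ K.HasDir v b := by
  constructor
  · intro h
    obtain ⟨h1, h2 | h2⟩ := K.step_spec h
    · exact Or.inl ⟨_, h1, h2⟩
    · exact Or.inr ⟨_, h1, h2⟩
  · rintro (⟨w, h1, h2⟩ | ⟨w, h1, h2⟩)
    · rw [K.step_eq hab h1 (Or.inl h2)]; exact K.ne_of_adj h1
    · rw [K.step_eq hab h1 (Or.inr h2)]; exact K.ne_of_adj h1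

theorem step_neg_step {a b : ℂ} (hab : a = b ∨ a ^ 3 ≠ b ^ 3) {v : V} (h : K.step a b v ≠ v) :
    K.step (-a) (-b) (K.step a b v) = v := by
  obtain ⟨h1, h2⟩ := K.step_spec h
  refine K.step_eq ?_ (K.symm h1) ?_
  · rcases hab with rfl | hab
    · exact Or.inl rfl
    · right
      rw [Odd.neg_pow (by decide), Odd.neg_pow (by decide)]
      exact fun h => hab (neg_injective h)
  · rw [K.dir_swap h1]
    rcases h2 with h2 | h2 <;> simp [h2]

theorem HasDir.cube_eq {v : V} {d d' : ℂ} (h : K.HasDir v d) (h' : K.HasDir v d') :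
    d ^ 3 = d' ^ 3 := by
  obtain ⟨w, h1, rfl⟩ := h
  obtain ⟨w', h2, rfl⟩ := h'
  exact K.dir_cube h1 h2

theorem HasDir.of_interior {v : V} {d d' : ℂ} (h : K.HasDir v d) (hv : K.interior v)
    (hd : d' ^ 3 = d ^ 3) : K.HasDir v d' := by
  obtain ⟨w, h1, rfl⟩ := h
  exact K.full hv h1 hd

theorem HasDir.eq_of_leaf {v : V} {d d' : ℂ} (hv : ¬ K.interior v) (h : K.HasDir v d)
    (h' : K.HasDir v d') : d = d' := by
  obtain ⟨w, h1, rfl⟩ := h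
  obtain ⟨w', h2, rfl⟩ := h'
  rw [K.leaf hv h1 h2]

theorem one_cube_ne {b : ℂ} (hb : b ^ 3 = -1) : (1 : ℂ) ^ 3 ≠ b ^ 3 := by
  rw [hb]; norm_num

theorem neg_cube_ne {a b : ℂ} (h : a ^ 3 ≠ b ^ 3) : (-a) ^ 3 ≠ (-b) ^ 3 := by
  rw [Odd.neg_pow (by decide), Odd.neg_pow (by decide)]
  exact fun h' => h (neg_injective h')

theorem re_lt_of_dir {v w : V} (h : K.adj v w) (hd : 0 < (K.dir v w).re) :
    (K.pos v).re < (K.pos w).re := by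
  obtain ⟨r, hr, hw⟩ := K.pos_eq h
  rw [hw, Complex.add_re, Complex.re_ofReal_mul]
  have := mul_pos hr hd
  linarith

theorem im_sub_of_dir {v w : V} (h : K.adj v w) :
    ∃ r : ℝ, 0 < r ∧ (K.pos w).im = (K.pos v).im + r * (K.dir v w).im := by
  obtain ⟨r, hr, hw⟩ := K.pos_eq h
  exact ⟨r, hr, by rw [hw, Complex.add_im, Complex.im_ofReal_mul]⟩

theorem dir_eq_of_not_hasDir {b : ℂ} {v : V} (hv : ¬ K.HasDir v 1)
    (h : K.step 1 b v ≠ v) : K.dir v (K.step 1 b v) = b := by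
  obtain ⟨h1, h2⟩ := K.step_spec h
  rcases h2 with h2 | h2
  · exact absurd ⟨_, h1, h2⟩ hv
  · exact h2

/-- The zigzags in the directions `1`, `exp (± π i / 3)`. -/
noncomputable def zigzagPair : ZigzagPair V where
  up := K.step 1 sixthRoot
  upInv := K.step (-1) (-sixthRoot)
  -- `1 - sixthRoot` is the inverse of `sixthRoot`, that is, exp(-πi/3).
  down := K.step 1 (1 - sixthRoot)
  downInv := K.step (-1) (-(1 - sixthRoot))
  abscissa := fun v => (K.pos v).re
  height := fun v => (K.pos v).im
  tails := fun v => K.HasDir v 1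
  heads := fun v => K.HasDir v (-1)
  upInv_up := fun v hv => K.step_neg_step (Or.inr (one_cube_ne sixthRoot_cube)) hv
  up_upInv := fun v hv => by
    have := K.step_neg_step (Or.inr (neg_cube_ne (one_cube_ne sixthRoot_cube))) hv
    rwa [neg_neg, neg_neg] at this
  downInv_down := fun v hv => K.step_neg_step (Or.inr (one_cube_ne cube_one_sub_sixthRoot)) hv
  down_downInv := fun v hv => by
    have := K.step_neg_step (Or.inr (neg_cube_ne (one_cube_ne cube_one_sub_sixthRoot))) hv
    rwa [neg_neg, neg_neg] at this
  abscissa_up := fun v hv => by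
    obtain ⟨h1, h2⟩ := K.step_spec hv
    apply K.re_lt_of_dir h1
    rcases h2 with h2 | h2 <;> rw [h2] <;> norm_num [sixthRoot]
  abscissa_down := fun v hv => by
    obtain ⟨h1, h2⟩ := K.step_spec hv
    apply K.re_lt_of_dir h1
    rcases h2 with h2 | h2 <;> rw [h2] <;> norm_num [sixthRoot]
  up_ne := fun v hv => (K.step_ne_iff (Or.inr (one_cube_ne sixthRoot_cube))).mpr (Or.inl hv)
  down_eq_up := fun v ⟨w, h1, h2⟩ => by
    rw [K.step_eq (Or.inr (one_cube_ne sixthRoot_cube)) h1 (Or.inl h2),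
      K.step_eq (Or.inr (one_cube_ne cube_one_sub_sixthRoot)) h1 (Or.inl h2)]
  height_eq := fun v ⟨w, h1, h2⟩ => by
    rw [K.step_eq (Or.inr (one_cube_ne sixthRoot_cube)) h1 (Or.inl h2)]
    obtain ⟨r, -, h⟩ := K.im_sub_of_dir h1
    rw [h, h2]; simp
  heads_up := fun v ⟨w, h1, h2⟩ => by
    rw [K.step_eq (Or.inr (one_cube_ne sixthRoot_cube)) h1 (Or.inl h2)]
    exact ⟨v, K.symm h1, by rw [K.dir_swap h1, h2]⟩
  upInv_ne := fun v hv =>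
    (K.step_ne_iff (Or.inr (neg_cube_ne (one_cube_ne sixthRoot_cube)))).mpr (Or.inl hv)
  downInv_eq_upInv := fun v ⟨w, h1, h2⟩ => by
    rw [K.step_eq (Or.inr (neg_cube_ne (one_cube_ne sixthRoot_cube))) h1 (Or.inl h2),
      K.step_eq (Or.inr (neg_cube_ne (one_cube_ne cube_one_sub_sixthRoot))) h1 (Or.inl h2)]
  tails_upInv := fun v ⟨w, h1, h2⟩ => by
    rw [K.step_eq (Or.inr (neg_cube_ne (one_cube_ne sixthRoot_cube))) h1 (Or.inl h2)]
    exact ⟨v, K.symm h1, by rw [K.dir_swap h1, h2, neg_neg]⟩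
  height_up := fun v hv hne => by
    obtain ⟨r, hr, h⟩ := K.im_sub_of_dir (K.step_spec hne).1
    rw [h, K.dir_eq_of_not_hasDir hv hne]
    have := mul_pos hr sixthRoot_im_pos
    linarith
  height_down := fun v hv hne => by
    obtain ⟨r, hr, h⟩ := K.im_sub_of_dir (K.step_spec hne).1
    rw [h, K.dir_eq_of_not_hasDir hv hne, Complex.sub_im, Complex.one_im]
    have := mul_pos hr sixthRoot_im_pos
    linarith
  not_heads := fun v hv hv' => by
    have := HasDir.cube_eq K hv hv'
    norm_num at this

theorem step_eq_self_of_leaf {a b d : ℂ} (hab : a = b ∨ a ^ 3 ≠ b ^ 3) {v : V}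
    (hI : ¬ K.interior v) (h : K.HasDir v d) (ha : d ≠ a) (hb : d ≠ b) : K.step a b v = v := by
  by_contra hne
  rcases (K.step_ne_iff hab).mp hne with h' | h'
  · exact ha (HasDir.eq_of_leaf K hI h h')
  · exact hb (HasDir.eq_of_leaf K hI h h')

variable [Fintype V]

open Classical in
/-- The non-interior vertices with an edge in the direction `d`. -/
noncomputable def leaves (d : ℂ) : Finset V := {v | ¬ K.interior v ∧ K.HasDir v d}

open Classical in
/-- The interior vertices with an edge in the direction `d`. -/
noncomputable def inner (d : ℂ) : Finset V := {v | K.interior v ∧ K.HasDir v d}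

open Classical in
theorem card_hasDir (d : ℂ) :
    (Finset.univ.filter fun v => K.HasDir v d).card = (K.inner d).card + (K.leaves d).card := by
  rw [inner, leaves, ← Finset.card_union_of_disjoint]
  · congr 1
    ext v
    simp only [Finset.mem_filter, Finset.mem_union, Finset.mem_univ, true_and]
    tauto
  · rw [Finset.disjoint_left]
    intro v hv hv'
    simp only [Finset.mem_filter] at hv hv'
    exact hv'.2.1 hv.2.1

theorem inner_eq {d d' : ℂ} (h : d ^ 3 = d' ^ 3) : K.inner d = K.inner d' := by
  ext v
  simp only [inner, Finset.mem_filter, Finset.mem_univ, true_and]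
  exact ⟨fun hv => ⟨hv.1, HasDir.of_interior K hv.2 hv.1 h.symm⟩,
    fun hv => ⟨hv.1, HasDir.of_interior K hv.2 hv.1 h⟩⟩

open Classical in
theorem card_hasDir_le (d : ℂ) :
    (Finset.univ.filter fun v => K.HasDir v d).card ≤
      (Finset.univ.filter fun v => K.HasDir v (-d)).card := by
  refine Finset.card_le_card_of_injOn (K.step d d) ?_ ?_
  · intro v hv
    simp only [Finset.coe_filter, Finset.mem_univ, true_and, Set.mem_ofPred_eq] at hv ⊢
    obtain ⟨w, h1, h2⟩ := hv
    rw [K.step_eq (Or.inl rfl) h1 (Or.inl h2)]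
    exact ⟨v, K.symm h1, by rw [K.dir_swap h1, h2]⟩
  · intro v hv v' hv' h
    simp only [Finset.coe_filter, Finset.mem_univ, true_and, Set.mem_ofPred_eq] at hv hv'
    rw [← K.step_neg_step (Or.inl rfl) ((K.step_ne_iff (Or.inl rfl)).mpr (Or.inl hv)), h,
      K.step_neg_step (Or.inl rfl) ((K.step_ne_iff (Or.inl rfl)).mpr (Or.inl hv'))]

/-- An edge seen in direction `d` from one end is seen in direction `-d` from the other. -/
theorem card_balance (d : ℂ) :
    (K.inner d).card + (K.leaves d).card = (K.inner (-d)).card + (K.leaves (-d)).card := by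
  classical
  rw [← card_hasDir, ← card_hasDir]
  refine le_antisymm (K.card_hasDir_le d) ?_
  have := K.card_hasDir_le (-d)
  rwa [neg_neg] at this

open Classical in
theorem card_interior_le :
    (Finset.univ.filter fun v => K.interior v).card ≤
      (K.inner 1).card + (K.inner (-1)).card := by
  refine (Finset.card_le_card fun v hv => ?_).trans (Finset.card_union_le _ _)
  simp only [Finset.mem_filter, Finset.mem_univ, true_and, Finset.mem_union, inner] at hv ⊢
  obtain ⟨w, hw⟩ := K.exists_adj v
  have h6 : (K.dir v w ^ 3 - 1) * (K.dir v w ^ 3 + 1) = 0 := by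
    linear_combination K.dir_six hw
  rcases mul_eq_zero.mp h6 with h | h
  · exact Or.inl ⟨hv, K.full hv hw (by linear_combination -h)⟩
  · exact Or.inr ⟨hv, K.full hv hw (by linear_combination -h)⟩

theorem disjoint_leaves {d d' : ℂ} (h : d ≠ d') : Disjoint (K.leaves d) (K.leaves d') := by
  rw [Finset.disjoint_left]
  intro v hv hv'
  simp only [leaves, Finset.mem_filter, Finset.mem_univ, true_and] at hv hv'
  exact h (HasDir.eq_of_leaf K hv.1 hv.2 hv'.2)

open Classical in
theorem sum_card_leaves_le :
    ∑ j ∈ Finset.range 6, (K.leaves (sixthRoot ^ j)).card ≤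
      (Finset.univ.filter fun v => ¬ K.interior v).card := by
  rw [← Finset.card_biUnion]
  · refine Finset.card_le_card fun v hv => ?_
    simp only [Finset.mem_biUnion, leaves, Finset.mem_filter, Finset.mem_univ, true_and] at hv ⊢
    obtain ⟨j, -, h, -⟩ := hv
    exact h
  · intro i hi j hj hij
    refine K.disjoint_leaves fun h => hij ?_
    exact isPrimitiveRoot_sixthRoot.pow_inj (Finset.mem_range.mp hi) (Finset.mem_range.mp hj) h

-- Zigzags start only at leaves: an interior vertex with an edge in direction `a` also has one in
-- direction `-b`, and one with `b` also has `-a`, since the cubes agree. Thus the zigzag continues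
-- backwards.
open Classical in
theorem card_starts {a b : ℂ} (ha : a ^ 3 = 1) (hb : b ^ 3 = -1) (hne : a ≠ -b) :
    (Finset.univ.filter fun v => K.step (-a) (-b) v = v ∧ K.step a b v ≠ v).card =
      (K.leaves a).card + (K.leaves b).card := by
  have hab : a ^ 3 ≠ b ^ 3 := by rw [ha, hb]; norm_num
  rw [← Finset.card_union_of_disjoint (K.disjoint_leaves (fun h => hab (by rw [h])))]
  congr 1
  ext v
  have h1 := K.step_ne_iff (v := v) (Or.inr (neg_cube_ne hab))
  rw [ne_eq, not_iff_comm, not_or] at h1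
  have ha0 : a ≠ -a := by
    intro h
    rw [self_eq_neg] at h
    subst h
    norm_num at ha
  have hb0 : b ≠ -b := by
    intro h
    rw [self_eq_neg] at h
    subst h
    norm_num at hb
  have hne' : b ≠ -a := fun h => hne (by rw [h, neg_neg])
  simp only [leaves, Finset.mem_filter, Finset.mem_univ, true_and, Finset.mem_union,
    K.step_ne_iff (Or.inr hab), ← h1]
  constructor
  · rintro ⟨⟨hna, hnb⟩, h⟩
    have hI : ¬ K.interior v := by
      intro hI
      rcases h with h | h
      · exact hnb (HasDir.of_interior K h hI (by
          rw [Odd.neg_pow (by decide), ha, hb, neg_neg]))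
      · exact hna (HasDir.of_interior K h hI (by
          rw [Odd.neg_pow (by decide), ha, hb]))
    exact h.imp (fun h => ⟨hI, h⟩) (fun h => ⟨hI, h⟩)
  · rintro (⟨hI, h⟩ | ⟨hI, h⟩)
    · exact ⟨⟨fun h' => ha0 (HasDir.eq_of_leaf K hI h h'),
        fun h' => hne (HasDir.eq_of_leaf K hI h h')⟩, Or.inl h⟩
    · exact ⟨⟨fun h' => hne' (HasDir.eq_of_leaf K hI h h'),
        fun h' => hb0 (HasDir.eq_of_leaf K hI h h')⟩, Or.inr h⟩

theorem two_mul_card_hasDir_one_le :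
    2 * ((K.inner 1).card + (K.leaves 1).card) + (K.leaves 1).card * (K.leaves 1).card +
        (K.leaves (-1)).card * (K.leaves (-1)).card ≤
      2 * (((K.leaves 1).card + (K.leaves sixthRoot).card) *
        ((K.leaves 1).card + (K.leaves (1 - sixthRoot)).card)) +
        (K.leaves 1).card + (K.leaves (-1)).card := by
  classical
  have him := sixthRoot_im_pos
  have hz1 : (1 : ℂ) ≠ -sixthRoot := by
    intro h; have := congrArg Complex.im h; simp at this; linarith
  have hz2 : (1 : ℂ) ≠ -(1 - sixthRoot) := by
    intro h; have := congrArg Complex.im h; simp at this; linarith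
  have hn : (1 : ℂ) ≠ -1 := by norm_num
  have hup := one_cube_ne sixthRoot_cube
  have hdown := one_cube_ne cube_one_sub_sixthRoot
  rw [← K.card_hasDir, ← K.card_starts (one_pow 3) sixthRoot_cube hz1,
    ← K.card_starts (one_pow 3) cube_one_sub_sixthRoot hz2]
  refine K.zigzagPair.two_mul_card_tails_le ?_ _ _ _ _ _ ?_ ?_ ?_ ?_ ?_
  -- The left end of such a step is a leaf. The right end is then interior, because no edge joins
  -- two leaves, and so it has an edge in direction `sixthRoot`.
  · intro v hv h1 h2 h3
    have hI : ¬ K.interior v := by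
      intro hI
      refine (K.step_ne_iff (Or.inr (neg_cube_ne hup))).mpr (Or.inr ?_) h1
      exact HasDir.of_interior K hv hI (by
        rw [Odd.neg_pow (by decide), sixthRoot_cube]; norm_num)
    obtain ⟨w, hw, hd⟩ := hv
    have h4 : K.zigzagPair.up v = w := K.step_eq (Or.inr hup) hw (Or.inl hd)
    rw [h4] at h3
    have hw' : K.interior w := (K.interior_of_adj hw).resolve_left hI
    refine (K.step_ne_iff (Or.inr hup)).mpr (Or.inr ?_) h3
    refine K.full hw' (K.symm hw) ?_
    rw [K.dir_swap hw, hd, sixthRoot_cube]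
    norm_num
  · intro v
    simp only [Finset.mem_filter, Finset.mem_univ, true_and]
    rfl
  · intro v
    simp only [Finset.mem_filter, Finset.mem_univ, true_and]
    rfl
  · intro v
    simp only [Finset.mem_filter, Finset.mem_univ, true_and]
    rfl
  · intro v
    simp only [leaves, Finset.mem_filter, Finset.mem_univ, true_and]
    constructor
    · rintro ⟨hI, h⟩
      exact ⟨h, K.step_eq_self_of_leaf (Or.inr (neg_cube_ne hup)) hI h hn hz1,
        K.step_eq_self_of_leaf (Or.inr (neg_cube_ne hdown)) hI h hn hz2⟩
    · rintro ⟨h, h1, -⟩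
      refine ⟨fun hI => ?_, h⟩
      refine (K.step_ne_iff (Or.inr (neg_cube_ne hup))).mpr (Or.inr ?_) h1
      exact HasDir.of_interior K h hI (by
        rw [Odd.neg_pow (by decide), sixthRoot_cube]; norm_num)
  · intro v
    simp only [leaves, Finset.mem_filter, Finset.mem_univ, true_and]
    constructor
    · rintro ⟨hI, h⟩
      exact ⟨h, K.step_eq_self_of_leaf (Or.inr hup) hI h hn.symm
          (fun h => hz1 (by rw [← h, neg_neg])),
        K.step_eq_self_of_leaf (Or.inr hdown) hI h hn.symm
          (fun h => hz2 (by rw [← h, neg_neg]))⟩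
    · rintro ⟨h, h1, -⟩
      refine ⟨fun hI => ?_, h⟩
      refine (K.step_ne_iff (Or.inr hup)).mpr (Or.inr ?_) h1
      exact HasDir.of_interior K h hI (by rw [sixthRoot_cube]; norm_num)

/-- Put x = a₀ + a₃, y = a₁ + a₄, z = a₂ + a₅ and δ = p - m. By the balances δ = a₃ - a₀ = a₁ - a₄ =
a₅ - a₂, so a₀ + a₁ = (x + y)/2 and a₀ + a₅ = (x + z)/2. The last hypothesis becomes 2(p + m) ≤ xy +
yz + zx - δ², and 3(xy + yz + zx) ≤ (x + y + z)². -/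
theorem six_mul_le_sq_of_balance {p m a₀ a₁ a₂ a₃ a₄ a₅ : ℕ} (h₀ : p + a₀ = m + a₃)
    (h₁ : m + a₁ = p + a₄) (h₂ : p + a₂ = m + a₅)
    (h : 2 * (p + a₀) + a₀ * a₀ + a₃ * a₃ ≤ 2 * ((a₀ + a₁) * (a₀ + a₅)) + a₀ + a₃) :
    6 * (p + m) ≤ (a₀ + a₁ + a₂ + a₃ + a₄ + a₅) ^ 2 := by
  zify at *
  generalize (p : ℤ) = p, (m : ℤ) = m, (a₀ : ℤ) = a₀, (a₁ : ℤ) = a₁, (a₂ : ℤ) = a₂,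
    (a₃ : ℤ) = a₃, (a₄ : ℤ) = a₄, (a₅ : ℤ) = a₅ at *
  obtain rfl : a₄ = m + a₁ - p := by linarith
  obtain rfl : a₅ = p + a₂ - m := by linarith
  obtain rfl : a₃ = p + a₀ - m := by linarith
  nlinarith [sq_nonneg (a₀ - (p + a₀ - m)),
    sq_nonneg (a₀ + (p + a₀ - m) - (a₁ + (m + a₁ - p))),
    sq_nonneg (a₀ + (p + a₀ - m) - (a₂ + (p + a₂ - m))),
    sq_nonneg (a₁ + (m + a₁ - p) - (a₂ + (p + a₂ - m)))]

open Classical in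
/-- Six times the number of interior vertices is at most the square of the number of leaves. -/
theorem six_mul_card_interior_le :
    6 * (Finset.univ.filter fun v => K.interior v).card ≤
      (Finset.univ.filter fun v => ¬ K.interior v).card ^ 2 := by
  have hs := K.sum_card_leaves_le
  simp only [Finset.sum_range_succ, Finset.sum_range_zero, pow_zero, pow_one, sixthRoot_sq,
    sixthRoot_cube, sixthRoot_pow_four, sixthRoot_pow_five, zero_add] at hs
  have h0 := K.card_balance 1
  have h1 := K.card_balance sixthRoot
  have h2 := K.card_balance (sixthRoot - 1)
  have hz : (sixthRoot - 1) ^ 3 = 1 := by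
    linear_combination -cube_one_sub_sixthRoot
  -- Odd powers of `sixthRoot` have cube -1 and even ones cube 1, so only `inner 1` and `inner (-1)`
  -- remain in the three balances.
  rw [K.inner_eq (d := sixthRoot) (d' := -1) (by rw [sixthRoot_cube]; norm_num),
    K.inner_eq (d := -sixthRoot) (d' := 1) (by
      rw [Odd.neg_pow (by decide), sixthRoot_cube]; norm_num)] at h1
  rw [K.inner_eq (d := sixthRoot - 1) (d' := 1) (by rw [hz]; norm_num),
    K.inner_eq (d := -(sixthRoot - 1)) (d' := -1) (by
      rw [Odd.neg_pow (by decide), hz]; norm_num), neg_sub] at h2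
  have := six_mul_le_sq_of_balance h0 h1 h2 K.two_mul_card_hasDir_one_le
  calc _ ≤ _ := Nat.mul_le_mul_left 6 K.card_interior_le
    _ ≤ _ := this
    _ ≤ _ := Nat.pow_le_pow_left hs 2

end HexGraph

/-! ### From minimal graphs to frames -/

/-- Conjugation inverts unit vectors, so conjugating `a + b + c = 0` and multiplying by `a * b * c`
gives the claim. Consequently `a`, `b`, `c` are the roots of X³ = abc. -/
theorem unit_sum_eq_zero {a b c : ℂ} (ha : ‖a‖ = 1) (hb : ‖b‖ = 1) (hc : ‖c‖ = 1)
    (h : a + b + c = 0) : a * b + b * c + c * a = 0 := by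
  have conj_eq : ∀ z : ℂ, ‖z‖ = 1 → z * (starRingEnd ℂ) z = 1 := fun z hz => by
    rw [Complex.mul_conj, Complex.normSq_eq_norm_sq, hz]; norm_num
  have h' := congrArg (starRingEnd ℂ) h
  rw [map_add, map_add, map_zero] at h'
  linear_combination (a * b * c) * h' - (b * c) * conj_eq a ha - (a * c) * conj_eq b hb -
    (a * b) * conj_eq c hc

theorem unit_ne_of_sum_eq_zero {a b c : ℂ} (hb : ‖b‖ = 1) (hc : ‖c‖ = 1)
    (h : a + b + c = 0) : a ≠ b := by
  rintro rfl
  have : c = -2 * a := by linear_combination h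
  rw [this, norm_mul, hb] at hc
  norm_num at hc

theorem cube_eq_of_root {a b c x : ℂ} (h1 : a + b + c = 0) (h2 : a * b + b * c + c * a = 0)
    (hx : x = a ∨ x = b ∨ x = c) : x ^ 3 = a * b * c := by
  rcases hx with rfl | rfl | rfl
  · linear_combination x ^ 2 * h1 - x * h2
  · linear_combination x ^ 2 * h1 - x * h2
  · linear_combination x ^ 2 * h1 - x * h2

theorem root_of_cube_eq {a b c x : ℂ} (h1 : a + b + c = 0) (h2 : a * b + b * c + c * a = 0)
    (hx : x ^ 3 = a * b * c) : x = a ∨ x = b ∨ x = c := by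
  have : (x - a) * ((x - b) * (x - c)) = 0 := by
    linear_combination hx - x ^ 2 * h1 + x * h2
  rcases mul_eq_zero.mp this with h | h
  · exact Or.inl (sub_eq_zero.mp h)
  rcases mul_eq_zero.mp h with h | h
  · exact Or.inr (Or.inl (sub_eq_zero.mp h))
  · exact Or.inr (Or.inr (sub_eq_zero.mp h))

/-- The isometry of the plane with the complex numbers. -/
noncomputable def planeToComplex : Plane ≃ₗᵢ[ℝ] ℂ := Complex.orthonormalBasisOneI.repr.symm

/-- The unit vector from `v` to `w`, as a complex number. -/
noncomputable def unitDir (v w : Plane) : ℂ := planeToComplex (‖w - v‖⁻¹ • (w - v))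

theorem unitDir_swap (v w : Plane) : unitDir w v = - unitDir v w := by
  rw [unitDir, unitDir, ← map_neg, norm_sub_rev, ← smul_neg, neg_sub]

theorem norm_unitDir {v w : Plane} (h : v ≠ w) : ‖unitDir v w‖ = 1 := by
  rw [unitDir, LinearIsometryEquiv.norm_map, norm_smul, norm_inv, norm_norm]
  exact inv_mul_cancel₀ (norm_ne_zero_iff.mpr (sub_ne_zero.mpr h.symm))

theorem planeToComplex_eq {v w : Plane} (h : v ≠ w) :
    planeToComplex w = planeToComplex v + (‖w - v‖ : ℝ) * unitDir v w := by
  have hn : ‖w - v‖ ≠ 0 := norm_ne_zero_iff.mpr (sub_ne_zero.mpr h.symm)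
  rw [unitDir, ← Complex.real_smul, ← map_smul, smul_smul, mul_inv_cancel₀ hn, one_smul, map_sub]
  ring

namespace PlaneGraph

variable {G : PlaneGraph} {A : Finset Plane}

theorem mem_neighbors {v w : Plane} : w ∈ G.neighbors v ↔ G.graph.Adj v w := by
  classical
  rw [neighbors, Finset.mem_filter]
  exact ⟨fun h => h.2, fun h => ⟨G.mem_verts_of_adj _ _ h.symm, h⟩⟩

theorem degree_eq_one_or_three (hG : G.IsMinimal A) (hreg : G.IsRegularOff 3 A) {v : Plane}
    (hv : v ∈ G.verts) : G.degree v = 1 ∨ G.degree v = 3 := by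
  by_cases h : v ∈ A
  · exact Or.inl (hG.degree_eq_one v h)
  · exact Or.inr (hreg v hv h)

theorem eq_of_degree_one {v w w' : Plane} (h : G.degree v = 1) (hw : G.graph.Adj v w)
    (hw' : G.graph.Adj v w') : w = w' :=
  Finset.card_le_one.mp (le_of_eq h) w (mem_neighbors.mpr hw) w' (mem_neighbors.mpr hw')

theorem exists_neighbors (hG : G.IsMinimal A) {v : Plane} (hv : v ∈ G.verts)
    (h : G.degree v = 3) : ∃ x y z, (∀ w, G.graph.Adj v w ↔ w = x ∨ w = y ∨ w = z) ∧
      unitDir v x + unitDir v y + unitDir v z = 0 ∧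
      unitDir v x * unitDir v y + unitDir v y * unitDir v z + unitDir v z * unitDir v x = 0 ∧
      unitDir v x ≠ unitDir v y ∧ unitDir v y ≠ unitDir v z ∧ unitDir v z ≠ unitDir v x := by
  classical
  obtain ⟨x, y, z, hxy, hxz, hyz, hN⟩ := Finset.card_eq_three.mp h
  have hmem : ∀ w, G.graph.Adj v w ↔ w = x ∨ w = y ∨ w = z := fun w => by
    rw [← mem_neighbors, hN]; simp
  have hsum := hG.balanced v hv (by omega)
  rw [hN, Finset.sum_insert (by simp [hxy, hxz]), Finset.sum_insert (by simp [hyz]),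
    Finset.sum_singleton] at hsum
  have hsum' := congrArg planeToComplex hsum
  rw [map_add, map_add, map_zero, ← add_assoc] at hsum'
  change unitDir v x + unitDir v y + unitDir v z = 0 at hsum'
  have hx := norm_unitDir ((hmem x).mpr (Or.inl rfl)).ne
  have hy := norm_unitDir ((hmem y).mpr (Or.inr (Or.inl rfl))).ne
  have hz := norm_unitDir ((hmem z).mpr (Or.inr (Or.inr rfl))).ne
  exact ⟨x, y, z, hmem, hsum', unit_sum_eq_zero hx hy hz hsum',
    unit_ne_of_sum_eq_zero hy hz hsum',
    unit_ne_of_sum_eq_zero hz hx (by linear_combination hsum'),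
    unit_ne_of_sum_eq_zero hx hy (by linear_combination hsum')⟩

theorem unitDir_cube (hG : G.IsMinimal A) (hreg : G.IsRegularOff 3 A) {v w w' : Plane}
    (hw : G.graph.Adj v w) (hw' : G.graph.Adj v w') : unitDir v w ^ 3 = unitDir v w' ^ 3 := by
  have hv := G.mem_verts_of_adj _ _ hw
  rcases degree_eq_one_or_three hG hreg hv with h | h
  · rw [eq_of_degree_one h hw hw']
  · obtain ⟨x, y, z, hN, h1, h2, -⟩ := exists_neighbors hG hv h
    rw [cube_eq_of_root h1 h2, cube_eq_of_root h1 h2]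
    · rcases (hN w').mp hw' with rfl | rfl | rfl <;> simp
    · rcases (hN w).mp hw with rfl | rfl | rfl <;> simp

theorem unitDir_inj (hG : G.IsMinimal A) (hreg : G.IsRegularOff 3 A) {v w w' : Plane}
    (hw : G.graph.Adj v w) (hw' : G.graph.Adj v w') (h : unitDir v w = unitDir v w') :
    w = w' := by
  have hv := G.mem_verts_of_adj _ _ hw
  rcases degree_eq_one_or_three hG hreg hv with hd | hd
  · rw [eq_of_degree_one hd hw hw']
  · obtain ⟨x, y, z, hN, -, -, h1, h2, h3⟩ := exists_neighbors hG hv hd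
    rcases (hN w).mp hw with rfl | rfl | rfl <;> rcases (hN w').mp hw' with rfl | rfl | rfl <;>
      first | rfl | exact absurd h (by assumption) | exact absurd h.symm (by assumption)

theorem exists_unitDir_eq (hG : G.IsMinimal A) {v w : Plane} (hv : G.degree v = 3)
    (hw : G.graph.Adj v w) {d : ℂ} (hd : d ^ 3 = unitDir v w ^ 3) :
    ∃ w', G.graph.Adj v w' ∧ unitDir v w' = d := by
  obtain ⟨x, y, z, hN, h1, h2, -⟩ := exists_neighbors hG (G.mem_verts_of_adj _ _ hw) hv
  rw [cube_eq_of_root h1 h2 (x := unitDir v w)] at hd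
  · rcases root_of_cube_eq h1 h2 hd with h | h | h
    · exact ⟨x, (hN x).mpr (by simp), h.symm⟩
    · exact ⟨y, (hN y).mpr (by simp), h.symm⟩
    · exact ⟨z, (hN z).mpr (by simp), h.symm⟩
  · rcases (hN w).mp hw with rfl | rfl | rfl <;> simp

variable (G) in
open Classical in
/-- The sixth power of the unit vectors along the edges at `v`. -/
noncomputable def frame (v : Plane) : ℂ :=
  if h : ∃ w, G.graph.Adj v w then unitDir v h.choose ^ 6 else 0

theorem unitDir_six (hG : G.IsMinimal A) (hreg : G.IsRegularOff 3 A) {v w : Plane}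
    (hw : G.graph.Adj v w) : unitDir v w ^ 6 = G.frame v := by
  have h : ∃ w, G.graph.Adj v w := ⟨w, hw⟩
  rw [frame, dif_pos h]
  have := unitDir_cube hG hreg hw h.choose_spec
  linear_combination (unitDir v w ^ 3 + unitDir v h.choose ^ 3) * this

theorem frame_eq (hG : G.IsMinimal A) (hreg : G.IsRegularOff 3 A) {v w : Plane}
    (hw : G.graph.Adj v w) : G.frame w = G.frame v := by
  rw [← unitDir_six hG hreg hw, ← unitDir_six hG hreg hw.symm, unitDir_swap,
    Even.neg_pow (by decide)]

theorem exists_adj (hG : G.IsMinimal A) (hreg : G.IsRegularOff 3 A) {v : Plane}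
    (hv : v ∈ G.verts) : ∃ w, G.graph.Adj v w := by
  have : 0 < (G.neighbors v).card := by
    rcases degree_eq_one_or_three hG hreg hv with h | h <;> rw [degree] at h <;> omega
  obtain ⟨w, hw⟩ := Finset.card_pos.mp this
  exact ⟨w, mem_neighbors.mp hw⟩

variable (G) in
open Classical in
/-- The vertices with edges in the frame `t`, without those on components with a single edge. -/
noncomputable def frameVerts (t : ℂ) : Finset Plane :=
  {v ∈ G.verts | G.frame v = t ∧
    (G.degree v = 3 ∨ ∃ w, G.graph.Adj v w ∧ G.degree w = 3)}

theorem mem_frameVerts {t : ℂ} {v : Plane} : v ∈ G.frameVerts t ↔ v ∈ G.verts ∧ G.frame v = t ∧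
    (G.degree v = 3 ∨ ∃ w, G.graph.Adj v w ∧ G.degree w = 3) := by
  classical
  rw [frameVerts, Finset.mem_filter]

theorem mem_frameVerts_of_adj (hG : G.IsMinimal A) (hreg : G.IsRegularOff 3 A) {t : ℂ}
    {v w : Plane} (hv : v ∈ G.frameVerts t) (hw : G.graph.Adj v w) : w ∈ G.frameVerts t := by
  rw [mem_frameVerts] at hv ⊢
  refine ⟨G.mem_verts_of_adj _ _ hw.symm, (frame_eq hG hreg hw).trans hv.2.1, ?_⟩
  by_cases h : G.degree v = 3
  · exact Or.inr ⟨v, hw.symm, h⟩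
  · have h1 := (degree_eq_one_or_three hG hreg hv.1).resolve_right h
    obtain ⟨u, hu, hu'⟩ := hv.2.2.resolve_left h
    rw [eq_of_degree_one h1 hw hu]
    exact Or.inl hu'

/-- The part of a minimal graph in a frame, turned so that the edges are in the directions of the
sixth roots of unity. -/
noncomputable def hexGraph (hG : G.IsMinimal A) (hreg : G.IsRegularOff 3 A) {t c : ℂ}
    (hc : c ≠ 0) (hct : c ^ 6 = t) : HexGraph (G.frameVerts t) where
  adj v w := G.graph.Adj v w
  pos v := planeToComplex v / c
  dir v w := unitDir v w / c
  interior v := G.degree v = 3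
  symm h := h.symm
  dir_swap {v w} _ := by rw [unitDir_swap, neg_div]
  pos_eq {v w} h := by
    refine ⟨‖(w : Plane) - v‖, norm_pos_iff.mpr (sub_ne_zero.mpr h.ne.symm), ?_⟩
    rw [planeToComplex_eq h.ne]
    ring
  dir_six {v w} h := by
    rw [div_pow, unitDir_six hG hreg h, (mem_frameVerts.mp v.2).2.1, hct]
    exact div_self (hct ▸ pow_ne_zero _ hc)
  dir_cube {v w w'} h h' := by rw [div_pow, div_pow, unitDir_cube hG hreg h h']
  dir_inj {v w w'} h h' hd := by
    apply Subtype.ext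
    refine unitDir_inj hG hreg h h' ?_
    rwa [div_left_inj' hc] at hd
  exists_adj v := by
    obtain ⟨w, hw⟩ := exists_adj hG hreg (mem_frameVerts.mp v.2).1
    exact ⟨⟨w, mem_frameVerts_of_adj hG hreg v.2 hw⟩, hw⟩
  full {v w d} hv h hd := by
    obtain ⟨w', h1, h2⟩ := exists_unitDir_eq hG hv h (d := d * c) (by
      rw [mul_pow, hd, div_pow]
      field_simp)
    refine ⟨⟨w', mem_frameVerts_of_adj hG hreg v.2 h1⟩, h1, ?_⟩
    rw [h2, mul_div_assoc, div_self hc, mul_one]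
  leaf {v w w'} hv h h' := by
    apply Subtype.ext
    exact eq_of_degree_one
      ((degree_eq_one_or_three hG hreg (mem_frameVerts.mp v.2).1).resolve_right hv) h h'
  interior_of_adj {v w} h := by
    by_cases hv : G.degree v = 3
    · exact Or.inl hv
    · right
      have hv' := mem_frameVerts.mp v.2
      have h1 := (degree_eq_one_or_three hG hreg hv'.1).resolve_right hv
      obtain ⟨u, hu, hu'⟩ := hv'.2.2.resolve_left hv
      rwa [eq_of_degree_one h1 h hu]

theorem degree_eq_three_iff (hG : G.IsMinimal A) (hreg : G.IsRegularOff 3 A) {v : Plane}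
    (hv : v ∈ G.verts) : G.degree v = 3 ↔ v ∉ A := by
  refine ⟨fun h hA => ?_, hreg v hv⟩
  rw [hG.degree_eq_one v hA] at h
  omega

open Classical in
theorem six_mul_card_frame_le (hG : G.IsMinimal A) (hreg : G.IsRegularOff 3 A) (t : ℂ) :
    6 * ((G.verts \ A).filter fun v => G.frame v = t).card ≤
      (A.filter fun v => G.frame v = t).card ^ 2 := by
  rcases ((G.verts \ A).filter fun v => G.frame v = t).eq_empty_or_nonempty with h0 | ⟨v₀, hv₀⟩
  · simp [h0]
  rw [Finset.mem_filter, Finset.mem_sdiff] at hv₀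
  obtain ⟨w₀, hw₀⟩ := exists_adj hG hreg hv₀.1.1
  -- Any edge of the frame supplies the rotation.
  have hc : unitDir v₀ w₀ ≠ 0 := by
    rw [← norm_ne_zero_iff, norm_unitDir hw₀.ne]; exact one_ne_zero
  have hct : unitDir v₀ w₀ ^ 6 = t := (unitDir_six hG hreg hw₀).trans hv₀.2
  have hK := (hexGraph hG hreg hc hct).six_mul_card_interior_le
  have h1 : ((G.verts \ A).filter fun v => G.frame v = t).card ≤
      (Finset.univ.filter fun v => (hexGraph hG hreg hc hct).interior v).card := by
    rw [← Finset.card_map (Function.Embedding.subtype fun v => v ∈ G.frameVerts t)]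
    refine Finset.card_le_card fun v hv => ?_
    rw [Finset.mem_filter, Finset.mem_sdiff] at hv
    have hd := (degree_eq_three_iff hG hreg hv.1.1).mpr hv.1.2
    have hm : v ∈ G.frameVerts t := mem_frameVerts.mpr ⟨hv.1.1, hv.2, Or.inl hd⟩
    exact Finset.mem_map.mpr ⟨⟨v, hm⟩, Finset.mem_filter.mpr ⟨Finset.mem_univ _, hd⟩, rfl⟩
  have h2 : (Finset.univ.filter fun v => ¬ (hexGraph hG hreg hc hct).interior v).card ≤
      (A.filter fun v => G.frame v = t).card := by
    rw [← Finset.card_map (Function.Embedding.subtype fun v => v ∈ G.frameVerts t)]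
    refine Finset.card_le_card fun v hv => ?_
    obtain ⟨⟨u, hu⟩, hu', rfl⟩ := Finset.mem_map.mp hv
    have hu1 := mem_frameVerts.mp hu
    have hu2 : ¬ G.degree u = 3 := (Finset.mem_filter.mp hu').2
    rw [degree_eq_three_iff hG hreg hu1.1, not_not] at hu2
    exact Finset.mem_filter.mpr ⟨hu2, hu1.2.1⟩
  calc _ ≤ _ := Nat.mul_le_mul_left 6 h1
    _ ≤ _ := hK
    _ ≤ _ := Nat.pow_le_pow_left h2 2

/-- Six times the number of vertices of degree `3` of a `3`-regular minimal graph is at most the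
square of the number of attaching points. -/
theorem six_mul_card_le (hG : G.IsMinimal A) (hreg : G.IsRegularOff 3 A) :
    6 * (G.verts \ A).card ≤ A.card ^ 2 := by
  classical
  set T := G.verts.image G.frame
  rw [Finset.card_eq_sum_card_fiberwise (f := G.frame) (t := T) (s := G.verts \ A)
      (fun v hv => Finset.mem_image_of_mem _ (Finset.mem_sdiff.mp hv).1),
    Finset.card_eq_sum_card_fiberwise (f := G.frame) (t := T) (s := A)
      (fun v hv => Finset.mem_image_of_mem _ (hG.subset_verts hv)), Finset.mul_sum]
  refine (Finset.sum_le_sum fun t _ => six_mul_card_frame_le hG hreg t).trans ?_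
  exact Finset.sum_sq_le_sq_sum_of_nonneg fun _ _ => Nat.zero_le _

/-! ### Parity -/

-- The degree sum counts ordered adjacent pairs, on which swapping is an involution without fixed
-- points.
variable (G) in
theorem even_sum_degree : Even (∑ v ∈ G.verts, G.degree v) := by
  classical
  have h : ∑ v ∈ G.verts, G.degree v =
      ((G.verts ×ˢ G.verts).filter fun p => G.graph.Adj p.1 p.2).card := by
    rw [Finset.card_filter, Finset.sum_product]
    refine Finset.sum_congr rfl fun v _ => ?_
    rw [degree, neighbors, Finset.card_filter]
  rw [h, ← ZMod.natCast_eq_zero_iff_even, Finset.cast_card]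
  refine Finset.sum_involution (fun p _ => p.swap) ?_ ?_ ?_ ?_
  · intro p _; decide
  · intro p hp _ h
    have h1 := (Finset.mem_filter.mp hp).2
    exact h1.ne (congrArg Prod.snd h)
  · intro p hp
    simp only [Finset.mem_filter, Finset.mem_product, Prod.fst_swap, Prod.snd_swap] at hp ⊢
    exact ⟨⟨hp.1.2, hp.1.1⟩, hp.2.symm⟩
  · intro p _
    exact Prod.swap_swap p

theorem even_card_sdiff_add_card (hG : G.IsMinimal A) (hreg : G.IsRegularOff 3 A) :
    Even ((G.verts \ A).card + A.card) := by
  classical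
  have h := G.even_sum_degree
  rw [← Finset.sum_sdiff hG.subset_verts, Finset.sum_congr rfl hG.degree_eq_one,
    Finset.sum_congr rfl (g := fun _ => 3) (fun v hv =>
      hreg v (Finset.mem_sdiff.mp hv).1 (Finset.mem_sdiff.mp hv).2)] at h
  simp only [Finset.sum_const, smul_eq_mul, mul_one] at h
  rw [Nat.even_iff] at h ⊢
  omega

theorem exists_eq_add_of_mem_vertexCounts {n m : ℕ} (h : m ∈ vertexCounts n) :
    ∃ v, m = v + n ∧ 6 * v ≤ n ^ 2 ∧ Even (v + n) := by
  obtain ⟨G, A, hG, hreg, rfl, rfl⟩ := h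
  exact ⟨(G.verts \ A).card, (Finset.card_sdiff_add_card_eq_card hG.subset_verts).symm,
    six_mul_card_le hG hreg, even_card_sdiff_add_card hG hreg⟩

end PlaneGraph

/-! ### Integral coordinates for the honeycomb -/

/-- The plane as the quotient of `ℝ³` by the diagonal: the basis vectors go to unit vectors at
angles of `120°`. -/
noncomputable def hexProj : (Fin 3 → ℝ) →ₗ[ℝ] Plane where
  toFun x := !₂[x 0 - (x 1 + x 2) / 2, √3 / 2 * (x 1 - x 2)]
  map_add' x y := by
    ext i
    fin_cases i <;> simp <;> ring
  map_smul' c x := by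
    ext i
    fin_cases i <;> simp <;> ring

theorem hexProj_apply (x : Fin 3 → ℝ) :
    hexProj x = !₂[x 0 - (x 1 + x 2) / 2, √3 / 2 * (x 1 - x 2)] := rfl

/-- The kernel of `hexProj` is the diagonal. -/
theorem sub_eq_sub_of_hexProj_eq {x y : Fin 3 → ℝ} (h : hexProj x = hexProj y) (i j : Fin 3) :
    x i - y i = x j - y j := by
  have h0 := congrArg (fun v : Plane => v 0) h
  have h1 := congrArg (fun v : Plane => v 1) h
  simp only [hexProj_apply, PiLp.toLp_apply, Matrix.cons_val_zero, Matrix.cons_val_one] at h0 h1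
  have h2 : x 1 - x 2 = y 1 - y 2 :=
    mul_left_cancel₀ (by positivity : √3 / 2 ≠ 0) h1
  fin_cases i <;> fin_cases j <;> simp only [Fin.zero_eta, Fin.mk_one, Fin.reduceFinMk] <;> linarith

theorem norm_hexProj_single (i : Fin 3) : ‖hexProj (Pi.single i 1)‖ = 1 := by
  have h : √3 ^ 2 = 3 := Real.sq_sqrt (by norm_num)
  rw [EuclideanSpace.norm_eq, Real.sqrt_eq_one, Fin.sum_univ_two, hexProj_apply]
  fin_cases i <;> simp [div_pow, h] <;> norm_num

theorem sum_hexProj_single : ∑ i, hexProj (Pi.single i 1) = 0 := by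
  rw [← map_sum, hexProj_apply]
  ext i
  fin_cases i <;> simp

/-- The point of the plane with integral coordinates `t`. -/
noncomputable def latticePt (t : Fin 3 → ℤ) : Plane := hexProj fun j => (t j : ℝ)

/-- The point of the plane at distance `θ` from the lattice point `t` in the direction `i`. -/
noncomputable def edgePt (t : Fin 3 → ℤ) (i : Fin 3) (θ : ℝ) : Plane :=
  hexProj fun j => (t j : ℝ) + if j = i then θ else 0

theorem latticePt_add_single (t : Fin 3 → ℤ) (i : Fin 3) (c : ℤ) :
    latticePt (t + Pi.single i c) = latticePt t + (c : ℝ) • hexProj (Pi.single i 1) := by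
  rw [latticePt, latticePt, ← map_smul, ← map_add]
  congr 1
  ext j
  by_cases h : j = i
  · subst h; simp
  · simp [h]

theorem exists_edgePt_of_mem_openSegment {t : Fin 3 → ℤ} {i : Fin 3} {p : Plane}
    (h : p ∈ openSegment ℝ (latticePt t) (latticePt (t + Pi.single i 1))) :
    ∃ θ, 0 < θ ∧ θ < 1 ∧ p = edgePt t i θ := by
  obtain ⟨a, b, ha, hb, hab, rfl⟩ := h
  refine ⟨b, hb, by linarith, ?_⟩
  rw [latticePt, latticePt, ← map_smul, ← map_smul, ← map_add, edgePt]
  congr 1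
  ext j
  obtain rfl : a = 1 - b := by linarith
  by_cases h : j = i
  · subst h
    simp only [Pi.add_apply, Pi.smul_apply, Pi.single_eq_same, smul_eq_mul, if_true]
    push_cast
    ring
  · simp only [Pi.add_apply, Pi.smul_apply, Pi.single_eq_of_ne h, smul_eq_mul, if_neg h, add_zero]
    ring

theorem Int.cast_ne_of_pos_of_lt_one {θ : ℝ} (h0 : 0 < θ) (h1 : θ < 1) (c : ℤ) :
    θ ≠ (c : ℝ) := by
  rintro rfl
  have : 0 < c := by exact_mod_cast h0
  have : c < 1 := by exact_mod_cast h1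
  omega

theorem Fin.three_add_one_ne : ∀ i : Fin 3, i + 1 ≠ i := by decide

theorem Fin.exists_three_ne : ∀ i j : Fin 3, ∃ k, k ≠ i ∧ k ≠ j := by decide

/-- Coordinate differences survive the projection. They are integers at lattice points, whereas an
inner point of an edge has one that is off by `θ`. -/
theorem edgePt_ne_latticePt {t t' : Fin 3 → ℤ} {i : Fin 3} {θ : ℝ} (h0 : 0 < θ) (h1 : θ < 1) :
    edgePt t i θ ≠ latticePt t' := by
  intro h
  have hi := Fin.three_add_one_ne i
  have := sub_eq_sub_of_hexProj_eq h i (i + 1)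
  simp only [if_true, if_neg hi] at this
  refine Int.cast_ne_of_pos_of_lt_one h0 h1 (t' i - t i + t (i + 1) - t' (i + 1)) ?_
  push_cast
  linarith

/-- The sum of the coordinates. -/
def coordSum (t : Fin 3 → ℤ) : ℤ := ∑ i, t i

theorem coordSum_add_single (t : Fin 3 → ℤ) (i : Fin 3) (c : ℤ) :
    coordSum (t + Pi.single i c) = coordSum t + c := by
  simp [coordSum, Finset.sum_add_distrib]

/-- A diagonal shift changes the coordinate sum by a multiple of 3, so the projection is injective
on two consecutive layers. -/
theorem eq_of_sub_eq_of_coordSum {t t' : Fin 3 → ℤ} (i : Fin 3)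
    (h : ∀ j, t j - t' j = t i - t' i) (hs : |coordSum t - coordSum t'| ≤ 1) : t = t' := by
  have h1 : coordSum t - coordSum t' = 3 * (t i - t' i) := by
    rw [coordSum, coordSum, ← Finset.sum_sub_distrib, Finset.sum_congr rfl fun j _ => h j]
    simp only [Finset.sum_const, Finset.card_univ, Fintype.card_fin, nsmul_eq_mul]
    rfl
  rw [h1, abs_le] at hs
  ext j
  have := h j
  omega

theorem latticePt_inj {t t' : Fin 3 → ℤ} (h : latticePt t = latticePt t')
    (hs : |coordSum t - coordSum t'| ≤ 1) : t = t' := by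
  refine eq_of_sub_eq_of_coordSum 0 (fun j => ?_) hs
  have := sub_eq_sub_of_hexProj_eq h j 0
  exact_mod_cast this

/-- For equal directions `θ - θ'` is an integer strictly between -1 and 1. For different directions,
comparison with the third coordinate would make `θ` an integer. -/
theorem edgePt_inj {t t' : Fin 3 → ℤ} {i i' : Fin 3} {θ θ' : ℝ} (h0 : 0 < θ) (h1 : θ < 1)
    (h0' : 0 < θ') (h1' : θ' < 1) (h : edgePt t i θ = edgePt t' i' θ')
    (hs : coordSum t = coordSum t') : t = t' ∧ i = i' := by
  have key := sub_eq_sub_of_hexProj_eq h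
  by_cases hi : i = i'
  · subst hi
    refine ⟨eq_of_sub_eq_of_coordSum i (fun j => ?_) (by rw [hs]; simp), rfl⟩
    by_cases hj : j = i
    · rw [hj]
    · have h2 := key i j
      simp only [if_true, if_neg hj] at h2
      have h3 : θ - θ' = ((t j - t' j - (t i - t' i) : ℤ) : ℝ) := by push_cast; linarith
      have h4 : ((t j - t' j - (t i - t' i) : ℤ) : ℝ) < (1 : ℤ) := by
        rw [← h3]; push_cast; linarith
      have h5 : ((-1 : ℤ) : ℝ) < ((t j - t' j - (t i - t' i) : ℤ) : ℝ) := by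
        rw [← h3]; push_cast; linarith
      rw [Int.cast_lt] at h4 h5
      omega
  · exfalso
    obtain ⟨j, hj, hj'⟩ := Fin.exists_three_ne i i'
    have h2 := key i j
    simp only [if_true, if_neg hj, if_neg hi, if_neg hj'] at h2
    refine Int.cast_ne_of_pos_of_lt_one h0 h1 (t' i - t i + t j - t' j) ?_
    push_cast
    linarith

/-! ### The honeycomb graph cut out by a box -/

namespace HexBox

variable (ℓ : Fin 3 → ℕ) (s : ℤ)

/-- The box of integral points with coordinates in `[0, ℓ i)`. -/
def InBox (t : Fin 3 → ℤ) : Prop := ∀ i, 0 ≤ t i ∧ t i < ℓ i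

/-- The honeycomb edge from `t` in the direction `i` has an end point in the box. -/
def IsEdge (t : Fin 3 → ℤ) (i : Fin 3) : Prop :=
  coordSum t = s ∧ (InBox ℓ t ∨ InBox ℓ (t + Pi.single i 1))

open Classical in
/-- The points of the box with coordinate sum `σ`. -/
noncomputable def layer (σ : ℤ) : Finset (Fin 3 → ℤ) :=
  {t ∈ Finset.Icc (fun _ => -1) (fun i => (ℓ i : ℤ)) | InBox ℓ t ∧ coordSum t = σ}

open Classical in
/-- The points with coordinate sum `σ` with `i`-th coordinate `c` and the others as in the box. -/
noncomputable def side (i : Fin 3) (c : ℤ) (σ : ℤ) : Finset (Fin 3 → ℤ) :=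
  {t ∈ Finset.Icc (fun _ => -1) (fun i => (ℓ i : ℤ)) |
    (∀ j ≠ i, 0 ≤ t j ∧ t j < ℓ j) ∧ t i = c ∧ coordSum t = σ}

theorem mem_layer {σ : ℤ} {t : Fin 3 → ℤ} : t ∈ layer ℓ σ ↔ InBox ℓ t ∧ coordSum t = σ := by
  classical
  rw [layer, Finset.mem_filter, Finset.mem_Icc, Pi.le_def, Pi.le_def, and_iff_right_iff_imp]
  exact fun h => ⟨fun i => by have := h.1 i; omega, fun i => (h.1 i).2.le⟩

theorem mem_side {i : Fin 3} {c σ : ℤ} (h1 : -1 ≤ c) (h2 : c ≤ ℓ i) {t : Fin 3 → ℤ} :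
    t ∈ side ℓ i c σ ↔ (∀ j ≠ i, 0 ≤ t j ∧ t j < ℓ j) ∧ t i = c ∧ coordSum t = σ := by
  classical
  rw [side, Finset.mem_filter, Finset.mem_Icc, Pi.le_def, Pi.le_def, and_iff_right_iff_imp]
  intro h
  constructor <;> intro j <;> by_cases hj : j = i
  · subst hj; rw [h.2.1]; exact h1
  · have := h.1 j hj; omega
  · subst hj; rw [h.2.1]; exact h2
  · exact (h.1 j hj).2.le

open Classical in
/-- The points of the box on the two middle layers. -/
noncomputable def inner : Finset (Fin 3 → ℤ) := layer ℓ s ∪ layer ℓ (s + 1)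

open Classical in
/-- The points off the box which are end points of edges. -/
noncomputable def outer : Finset (Fin 3 → ℤ) :=
  Finset.univ.biUnion fun i => side ℓ i (-1) s ∪ side ℓ i (ℓ i) (s + 1)

theorem mem_inner {t : Fin 3 → ℤ} :
    t ∈ inner ℓ s ↔ InBox ℓ t ∧ (coordSum t = s ∨ coordSum t = s + 1) := by
  classical
  rw [inner, Finset.mem_union, mem_layer, mem_layer]
  tauto

theorem mem_outer {t : Fin 3 → ℤ} : t ∈ outer ℓ s ↔ ∃ i, (∀ j ≠ i, 0 ≤ t j ∧ t j < ℓ j) ∧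
    ((t i = -1 ∧ coordSum t = s) ∨ (t i = ℓ i ∧ coordSum t = s + 1)) := by
  classical
  rw [outer, Finset.mem_biUnion]
  refine exists_congr fun i => ?_
  rw [Finset.mem_union, mem_side ℓ (by omega) (by omega), mem_side ℓ (by omega) (by omega)]
  simp only [Finset.mem_univ, true_and]
  tauto

theorem inBox_add_single_iff {t : Fin 3 → ℤ} {i : Fin 3} {c : ℤ} :
    InBox ℓ (t + Pi.single i c) ↔
      (∀ j ≠ i, 0 ≤ t j ∧ t j < ℓ j) ∧ 0 ≤ t i + c ∧ t i + c < ℓ i := by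
  constructor
  · intro h
    refine ⟨fun j hj => ?_, ?_⟩
    · have := h j
      rwa [Pi.add_apply, Pi.single_eq_of_ne hj, add_zero] at this
    · have := h i
      rwa [Pi.add_apply, Pi.single_eq_same] at this
  · rintro ⟨h1, h2⟩ j
    by_cases hj : j = i
    · subst hj
      rwa [Pi.add_apply, Pi.single_eq_same]
    · rw [Pi.add_apply, Pi.single_eq_of_ne hj, add_zero]
      exact h1 j hj

theorem inBox_iff {t : Fin 3 → ℤ} (i : Fin 3) :
    InBox ℓ t ↔ (∀ j ≠ i, 0 ≤ t j ∧ t j < ℓ j) ∧ 0 ≤ t i ∧ t i < ℓ i := by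
  have := inBox_add_single_iff ℓ (t := t) (i := i) (c := 0)
  simpa using this

theorem coordSum_of_mem {t : Fin 3 → ℤ} (h : t ∈ inner ℓ s ∨ t ∈ outer ℓ s) :
    coordSum t = s ∨ coordSum t = s + 1 := by
  rcases h with h | h
  · exact ((mem_inner ℓ s).mp h).2
  · obtain ⟨i, -, h | h⟩ := (mem_outer ℓ s).mp h
    · exact Or.inl h.2
    · exact Or.inr h.2

variable {ℓ s}

theorem IsEdge.tail_mem {t : Fin 3 → ℤ} {i : Fin 3} (h : IsEdge ℓ s t i) :
    t ∈ inner ℓ s ∨ t ∈ outer ℓ s := by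
  by_cases ht : InBox ℓ t
  · exact Or.inl ((mem_inner ℓ s).mpr ⟨ht, Or.inl h.1⟩)
  · right
    have h1 := (inBox_add_single_iff ℓ).mp (h.2.resolve_left ht)
    refine (mem_outer ℓ s).mpr ⟨i, h1.1, Or.inl ⟨?_, h.1⟩⟩
    rw [inBox_iff ℓ i] at ht
    by_contra h2
    exact ht ⟨h1.1, by omega⟩

theorem IsEdge.head_mem {t : Fin 3 → ℤ} {i : Fin 3} (h : IsEdge ℓ s t i) :
    t + Pi.single i 1 ∈ inner ℓ s ∨ t + Pi.single i 1 ∈ outer ℓ s := by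
  have hs : coordSum (t + Pi.single i 1) = s + 1 := by rw [coordSum_add_single, h.1]
  by_cases ht : InBox ℓ (t + Pi.single i 1)
  · exact Or.inl ((mem_inner ℓ s).mpr ⟨ht, Or.inr hs⟩)
  · right
    have h1 := (inBox_iff ℓ i).mp (h.2.resolve_right ht)
    refine (mem_outer ℓ s).mpr ⟨i, fun j hj => ?_, Or.inr ⟨?_, hs⟩⟩
    · rw [Pi.add_apply, Pi.single_eq_of_ne hj, add_zero]
      exact h1.1 j hj
    · rw [inBox_add_single_iff] at ht
      rw [Pi.add_apply, Pi.single_eq_same]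
      by_contra h2
      exact ht ⟨h1.1, by omega⟩

theorem latticePt_ne_add_single (t : Fin 3 → ℤ) (i : Fin 3) :
    latticePt t ≠ latticePt (t + Pi.single i 1) := by
  intro h
  have h1 := latticePt_inj h (by rw [coordSum_add_single]; simp)
  have h2 := congrArg coordSum h1
  rw [coordSum_add_single] at h2
  omega

variable (ℓ s)

open Classical in
/-- The part of the honeycomb inside a box, with the edges leaving the box. -/
noncomputable def planeGraph : PlaneGraph where
  verts := (inner ℓ s ∪ outer ℓ s).image latticePt
  graph :=
    { Adj := fun u v => ∃ t i, IsEdge ℓ s t i ∧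
        ((u = latticePt t ∧ v = latticePt (t + Pi.single i 1)) ∨
          (v = latticePt t ∧ u = latticePt (t + Pi.single i 1)))
      symm := ⟨fun u v ⟨t, i, h, h'⟩ => ⟨t, i, h, h'.symm⟩⟩
      loopless := ⟨by
        rintro u ⟨t, i, -, ⟨h1, h2⟩ | ⟨h1, h2⟩⟩ <;>
        exact latticePt_ne_add_single t i (h1.symm.trans h2)⟩ }
  mem_verts_of_adj := by
    rintro u v ⟨t, i, h, ⟨rfl, rfl⟩ | ⟨rfl, rfl⟩⟩
    · exact Finset.mem_image_of_mem _ (Finset.mem_union.mpr h.tail_mem)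
    · exact Finset.mem_image_of_mem _ (Finset.mem_union.mpr h.head_mem)
  vertex_notMem_edge := by
    have key : ∀ t i w, w ∈ (inner ℓ s ∪ outer ℓ s).image latticePt →
        w ∉ openSegment ℝ (latticePt t) (latticePt (t + Pi.single i 1)) := by
      intro t i w hw hw'
      obtain ⟨t', -, rfl⟩ := Finset.mem_image.mp hw
      obtain ⟨θ, h0, h1, h⟩ := exists_edgePt_of_mem_openSegment hw'
      exact edgePt_ne_latticePt h0 h1 h.symm
    rintro u v w ⟨t, i, -, ⟨rfl, rfl⟩ | ⟨rfl, rfl⟩⟩ hw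
    · exact key t i w hw
    · rw [openSegment_symm]
      exact key t i w hw
  edges_disjoint := by
    rintro u v x y ⟨t, i, h, h'⟩ ⟨t', i', g, g'⟩ hne
    have hseg : openSegment ℝ u v = openSegment ℝ (latticePt t) (latticePt (t + Pi.single i 1)) ∧
        s(u, v) = s(latticePt t, latticePt (t + Pi.single i 1)) := by
      rcases h' with ⟨rfl, rfl⟩ | ⟨rfl, rfl⟩
      · exact ⟨rfl, rfl⟩
      · exact ⟨openSegment_symm _ _ _, Sym2.eq_swap⟩
    have hseg' : openSegment ℝ x y =
        openSegment ℝ (latticePt t') (latticePt (t' + Pi.single i' 1)) ∧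
        s(x, y) = s(latticePt t', latticePt (t' + Pi.single i' 1)) := by
      rcases g' with ⟨rfl, rfl⟩ | ⟨rfl, rfl⟩
      · exact ⟨rfl, rfl⟩
      · exact ⟨openSegment_symm _ _ _, Sym2.eq_swap⟩
    rw [hseg.1, hseg'.1, Set.disjoint_left]
    intro p hp hp'
    obtain ⟨θ, h0, h1, rfl⟩ := exists_edgePt_of_mem_openSegment hp
    obtain ⟨θ', h0', h1', he⟩ := exists_edgePt_of_mem_openSegment hp'
    obtain ⟨rfl, rfl⟩ := edgePt_inj h0 h1 h0' h1' he (h.1.trans g.1.symm)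
    exact hne (hseg.2.trans hseg'.2.symm)

theorem adj_latticePt_iff {t : Fin 3 → ℤ} (ht : t ∈ inner ℓ s ∨ t ∈ outer ℓ s) {v : Plane} :
    (planeGraph ℓ s).graph.Adj (latticePt t) v ↔
      (coordSum t = s ∧ ∃ i, (InBox ℓ t ∨ InBox ℓ (t + Pi.single i 1)) ∧
        v = latticePt (t + Pi.single i 1)) ∨
      (coordSum t = s + 1 ∧ ∃ i, (InBox ℓ t ∨ InBox ℓ (t + Pi.single i (-1))) ∧
        v = latticePt (t + Pi.single i (-1))) := by
  have hs := coordSum_of_mem ℓ s ht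
  have hcancel : ∀ (u : Fin 3 → ℤ) i, u + Pi.single i 1 + Pi.single i (-1) = u := fun u i => by
    rw [add_assoc, ← Pi.single_add]; simp
  have hcancel' : ∀ (u : Fin 3 → ℤ) i, u + Pi.single i (-1) + Pi.single i 1 = u := fun u i => by
    rw [add_assoc, ← Pi.single_add]; simp
  constructor
  · rintro ⟨t', i, h, ⟨h1, rfl⟩ | ⟨rfl, h1⟩⟩
    · have := latticePt_inj h1 (by rw [h.1, abs_le]; omega)
      subst this
      exact Or.inl ⟨h.1, i, h.2, rfl⟩
    · have := latticePt_inj h1 (by rw [coordSum_add_single, h.1, abs_le]; omega)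
      subst this
      refine Or.inr ⟨by rw [coordSum_add_single, h.1], i, ?_, ?_⟩
      · rw [hcancel]; exact h.2.symm
      · rw [hcancel]
  · rintro (⟨h, i, hi, rfl⟩ | ⟨h, i, hi, rfl⟩)
    · exact ⟨t, i, ⟨h, hi⟩, Or.inl ⟨rfl, rfl⟩⟩
    · refine ⟨t + Pi.single i (-1), i, ⟨by rw [coordSum_add_single, h]; ring, ?_⟩,
        Or.inr ⟨rfl, by rw [hcancel']⟩⟩
      rw [hcancel']
      exact hi.symm

open Classical in
theorem neighbors_of_inner {t : Fin 3 → ℤ} (ht : t ∈ inner ℓ s) :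
    ∃ c : ℤ, (c = 1 ∨ c = -1) ∧ (planeGraph ℓ s).neighbors (latticePt t) =
      Finset.univ.image fun i => latticePt (t + Pi.single i c) := by
  obtain ⟨hb, hs⟩ := (mem_inner ℓ s).mp ht
  rcases hs with hs | hs
  · refine ⟨1, Or.inl rfl, ?_⟩
    ext v
    rw [PlaneGraph.mem_neighbors, adj_latticePt_iff ℓ s (Or.inl ht)]
    simp [hs, hb, eq_comm]
  · refine ⟨-1, Or.inr rfl, ?_⟩
    ext v
    rw [PlaneGraph.mem_neighbors, adj_latticePt_iff ℓ s (Or.inl ht)]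
    simp [hs, hb, eq_comm]

theorem latticePt_add_single_injective (t : Fin 3 → ℤ) {c : ℤ} (hc : c ≠ 0) :
    Function.Injective fun i => latticePt (t + Pi.single i c) := by
  intro i j h
  have h1 := latticePt_inj h (by simp [coordSum_add_single])
  have h2 := congrFun (add_left_cancel h1) i
  by_contra hij
  rw [Pi.single_eq_same, Pi.single_eq_of_ne hij] at h2
  exact hc h2

theorem degree_inner {t : Fin 3 → ℤ} (ht : t ∈ inner ℓ s) :
    (planeGraph ℓ s).degree (latticePt t) = 3 := by
  classical
  obtain ⟨c, hc, h⟩ := neighbors_of_inner ℓ s ht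
  rw [PlaneGraph.degree, h, Finset.card_image_of_injective _
    (latticePt_add_single_injective t (by omega))]
  simp

theorem balanced_inner {t : Fin 3 → ℤ} (ht : t ∈ inner ℓ s) :
    ∑ w ∈ (planeGraph ℓ s).neighbors (latticePt t),
      ‖w - latticePt t‖⁻¹ • (w - latticePt t) = 0 := by
  classical
  obtain ⟨c, hc, h⟩ := neighbors_of_inner ℓ s ht
  rw [h, Finset.sum_image fun i _ j _ hij =>
    latticePt_add_single_injective t (by omega : c ≠ 0) hij]
  have hn : ‖(c : ℝ)‖ = 1 := by rcases hc with rfl | rfl <;> simp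
  simp only [latticePt_add_single, add_sub_cancel_left, norm_smul, norm_hexProj_single, hn,
    mul_one, inv_one, one_smul]
  rw [← Finset.smul_sum, sum_hexProj_single, smul_zero]

/-- Exactly one coordinate of an outer point is off the box, by one unit, so only the step in that
coordinate leads inside. Positive side lengths ensure that this step does not cross the whole box.
-/
theorem neighbors_of_outer (hℓ : ∀ i, 0 < ℓ i) {t : Fin 3 → ℤ} (ht : t ∈ outer ℓ s) :
    ∃ w, (planeGraph ℓ s).neighbors (latticePt t) = {w} := by
  obtain ⟨i, hj, hi⟩ := (mem_outer ℓ s).mp ht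
  have hnot : ∀ k c, k ≠ i → ¬ InBox ℓ (t + Pi.single k c) := by
    intro k c hk h
    have := h i
    rw [Pi.add_apply, Pi.single_eq_of_ne hk.symm] at this
    omega
  have hnot' : ¬ InBox ℓ t := by
    intro h
    have := h i
    omega
  have hi0 := hℓ i
  rcases hi with ⟨hi, hs⟩ | ⟨hi, hs⟩
  · refine ⟨latticePt (t + Pi.single i 1), ?_⟩
    ext v
    rw [PlaneGraph.mem_neighbors, adj_latticePt_iff ℓ s (Or.inr ht), Finset.mem_singleton]
    constructor
    · rintro (⟨-, k, h | h, rfl⟩ | ⟨h, -⟩)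
      · exact absurd h hnot'
      · by_cases hk : k = i
        · rw [hk]
        · exact absurd h (hnot _ _ hk)
      · omega
    · rintro rfl
      exact Or.inl ⟨hs, i, Or.inr ((inBox_add_single_iff ℓ).mpr ⟨hj, by omega⟩), rfl⟩
  · refine ⟨latticePt (t + Pi.single i (-1)), ?_⟩
    ext v
    rw [PlaneGraph.mem_neighbors, adj_latticePt_iff ℓ s (Or.inr ht), Finset.mem_singleton]
    constructor
    · rintro (⟨h, -⟩ | ⟨-, k, h | h, rfl⟩)
      · omega
      · exact absurd h hnot'
      · by_cases hk : k = i
        · rw [hk]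
        · exact absurd h (hnot _ _ hk)
    · rintro rfl
      exact Or.inr ⟨hs, i, Or.inr ((inBox_add_single_iff ℓ).mpr ⟨hj, by omega⟩), rfl⟩

theorem degree_outer (hℓ : ∀ i, 0 < ℓ i) {t : Fin 3 → ℤ} (ht : t ∈ outer ℓ s) :
    (planeGraph ℓ s).degree (latticePt t) = 1 := by
  obtain ⟨w, hw⟩ := neighbors_of_outer ℓ s hℓ ht
  rw [PlaneGraph.degree, hw, Finset.card_singleton]

theorem disjoint_inner_outer : Disjoint (inner ℓ s) (outer ℓ s) := by
  rw [Finset.disjoint_left]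
  intro t ht ht'
  obtain ⟨i, -, hi⟩ := (mem_outer ℓ s).mp ht'
  have := ((mem_inner ℓ s).mp ht).1 i
  omega

theorem latticePt_injOn : Set.InjOn latticePt {t | t ∈ inner ℓ s ∨ t ∈ outer ℓ s} := by
  intro t ht t' ht' h
  have h1 := coordSum_of_mem ℓ s ht
  have h2 := coordSum_of_mem ℓ s ht'
  exact latticePt_inj h (by rw [abs_le]; omega)

theorem card_mem_vertexCounts (hℓ : ∀ i, 0 < ℓ i) :
    (inner ℓ s).card + (outer ℓ s).card ∈ PlaneGraph.vertexCounts (outer ℓ s).card := by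
  classical
  have hinj := latticePt_injOn ℓ s
  refine ⟨planeGraph ℓ s, (outer ℓ s).image latticePt, ⟨?_, ?_, ?_⟩, ?_, ?_, ?_⟩
  · exact Finset.image_subset_image Finset.subset_union_right
  · intro a ha
    obtain ⟨t, ht, rfl⟩ := Finset.mem_image.mp ha
    exact degree_outer ℓ s hℓ ht
  · intro v hv hd
    obtain ⟨t, ht, rfl⟩ := Finset.mem_image.mp hv
    rcases Finset.mem_union.mp ht with ht | ht
    · exact balanced_inner ℓ s ht
    · rw [degree_outer ℓ s hℓ ht] at hd
      omega
  · intro v hv hA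
    obtain ⟨t, ht, rfl⟩ := Finset.mem_image.mp hv
    rcases Finset.mem_union.mp ht with ht | ht
    · exact degree_inner ℓ s ht
    · exact absurd (Finset.mem_image_of_mem _ ht) hA
  · exact Finset.card_image_of_injOn (hinj.mono fun t ht => Or.inr ht)
  · rw [← Finset.card_union_of_disjoint (disjoint_inner_outer ℓ s)]
    refine Finset.card_image_of_injOn (hinj.mono fun t ht => ?_)
    exact Finset.mem_union.mp ht

end HexBox

/-! ### Counting the points of the honeycomb piece -/

namespace HexBox

/-- The integral points of the rectangle `[0, q) × [0, r)`. -/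
noncomputable def rect (q r : ℕ) : Finset (ℤ × ℤ) := Finset.Ico 0 (q : ℤ) ×ˢ Finset.Ico 0 (r : ℤ)

theorem mem_rect {q r : ℕ} {p : ℤ × ℤ} :
    p ∈ rect q r ↔ (0 ≤ p.1 ∧ p.1 < q) ∧ 0 ≤ p.2 ∧ p.2 < r := by
  rw [rect, Finset.mem_product, Finset.mem_Ico, Finset.mem_Ico]

theorem card_rect (q r : ℕ) : (rect q r).card = q * r := by
  rw [rect, Finset.card_product, Int.card_Ico, Int.card_Ico]
  simp

theorem card_diagonal {q r x : ℕ} (hq : x ≤ q) (hr : x ≤ r) :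
    ((rect q r).filter fun p : ℤ × ℤ => p.1 + p.2 + 1 = x).card = x := by
  have h : ((rect q r).filter fun p : ℤ × ℤ => p.1 + p.2 + 1 = x) =
      (Finset.Ico 0 (x : ℤ)).image fun b : ℤ => (b, (x : ℤ) - 1 - b) := by
    ext ⟨b, c⟩
    simp only [Finset.mem_filter, mem_rect, Finset.mem_image, Finset.mem_Ico, Prod.mk.injEq]
    constructor
    · rintro ⟨h, h'⟩
      exact ⟨b, by omega, rfl, by omega⟩
    · rintro ⟨a, h, rfl, rfl⟩
      omega
  rw [h, Finset.card_image_of_injective _ fun a b hab => congrArg Prod.fst hab, Int.card_Ico]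
  simp

theorem card_triangle {q r x : ℕ} (hq : x ≤ q + 1) (hr : x ≤ r + 1) :
    2 * ((rect q r).filter fun p : ℤ × ℤ => p.1 + p.2 + 1 < x).card + x = x * x := by
  induction x with
  | zero =>
    rw [Finset.filter_false_of_mem]
    · simp
    · intro p hp
      rw [mem_rect] at hp
      push_cast
      omega
  | succ x ih =>
    have h : ((rect q r).filter fun p : ℤ × ℤ => p.1 + p.2 + 1 < ((x + 1 : ℕ) : ℤ)) =
        ((rect q r).filter fun p : ℤ × ℤ => p.1 + p.2 + 1 < x) ∪
          ((rect q r).filter fun p : ℤ × ℤ => p.1 + p.2 + 1 = x) := by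
      rw [← Finset.filter_or]
      refine Finset.filter_congr fun p _ => ?_
      push_cast
      omega
    have hd : Disjoint ((rect q r).filter fun p : ℤ × ℤ => p.1 + p.2 + 1 < x)
        ((rect q r).filter fun p : ℤ × ℤ => p.1 + p.2 + 1 = x) :=
      Finset.disjoint_filter.mpr fun p _ h => h.ne
    rw [h, Finset.card_union_of_disjoint hd, card_diagonal (by omega) (by omega)]
    have := ih (by omega) (by omega)
    linarith

/-- The half turn of the rectangle exchanges opposite corners, so only one corner has to be counted.
-/
theorem card_filter_reflect {q r : ℕ} (P : ℤ → Prop) [DecidablePred P] :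
    ((rect q r).filter fun p : ℤ × ℤ => P (p.1 + p.2)).card =
      ((rect q r).filter fun p : ℤ × ℤ => P (q + r - 2 - (p.1 + p.2))).card := by
  refine Finset.card_bij' (fun p _ => (q - 1 - p.1, r - 1 - p.2))
    (fun p _ => (q - 1 - p.1, r - 1 - p.2)) ?_ ?_ ?_ ?_
  · intro p hp
    rw [Finset.mem_filter, mem_rect] at hp ⊢
    refine ⟨by omega, ?_⟩
    convert hp.2 using 1
    ring
  · intro p hp
    rw [Finset.mem_filter, mem_rect] at hp ⊢
    refine ⟨by omega, ?_⟩
    convert hp.2 using 1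
    ring
  · intro p _; simp
  · intro p _; simp

theorem Fin.three_cases : ∀ i j : Fin 3, j = i ∨ j = i + 1 ∨ j = i + 2 := by decide

theorem Fin.three_ne : ∀ i : Fin 3, i + 1 ≠ i ∧ i + 2 ≠ i ∧ i + 2 ≠ i + 1 := by decide

theorem coordSum_eq (t : Fin 3 → ℤ) (i : Fin 3) :
    coordSum t = t i + t (i + 1) + t (i + 2) := by
  rw [coordSum, Fin.sum_univ_three]
  fin_cases i <;> simp <;> ring

/-- The point with `i`-th coordinate `a` and the following ones `b` and `c`. -/
def cyclicPt (i : Fin 3) (a b c : ℤ) : Fin 3 → ℤ := fun j =>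
  if j = i then a else if j = i + 1 then b else c

theorem cyclicPt_apply (i : Fin 3) (a b c : ℤ) : cyclicPt i a b c i = a ∧
    cyclicPt i a b c (i + 1) = b ∧ cyclicPt i a b c (i + 2) = c := by
  obtain ⟨h1, h2, h3⟩ := Fin.three_ne i
  simp [cyclicPt, h1, h2, h3]

theorem card_eq_card_of_coord {F : Finset (Fin 3 → ℤ)} {R : Finset (ℤ × ℤ)} (i : Fin 3)
    (a : ℤ × ℤ → ℤ)
    (h : ∀ t, t ∈ F ↔ (t (i + 1), t (i + 2)) ∈ R ∧ t i = a (t (i + 1), t (i + 2))) :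
    F.card = R.card := by
  refine Finset.card_bij' (fun t _ => (t (i + 1), t (i + 2)))
    (fun p _ => cyclicPt i (a p) p.1 p.2) ?_ ?_ ?_ ?_
  · intro t ht
    exact ((h t).mp ht).1
  · intro p hp
    obtain ⟨h1, h2, h3⟩ := cyclicPt_apply i (a p) p.1 p.2
    rw [h, h1, h2, h3]
    exact ⟨hp, rfl⟩
  · intro t ht
    obtain ⟨h1, h2, h3⟩ := cyclicPt_apply i (a (t (i + 1), t (i + 2))) (t (i + 1)) (t (i + 2))
    ext j
    rcases Fin.three_cases i j with rfl | rfl | rfl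
    · rw [h1, ((h t).mp ht).2]
    · exact h2
    · exact h3
  · intro p hp
    obtain ⟨-, h2, h3⟩ := cyclicPt_apply i (a p) p.1 p.2
    exact Prod.ext h2 h3

theorem forall_ne_iff (P : Fin 3 → Prop) (i : Fin 3) :
    (∀ j ≠ i, P j) ↔ P (i + 1) ∧ P (i + 2) := by
  obtain ⟨h1, h2, -⟩ := Fin.three_ne i
  refine ⟨fun h => ⟨h _ h1, h _ h2⟩, fun h j hj => ?_⟩
  rcases Fin.three_cases i j with rfl | rfl | rfl
  · exact absurd rfl hj
  · exact h.1
  · exact h.2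

variable (ℓ : Fin 3 → ℕ)

/-- Eliminating the `i`-th coordinate turns the layer into a rectangle without two opposite corner
triangles, of sizes x(x - 1)/2 and y(y - 1)/2. The bounds on `x` and `y` keep these triangles inside
the rectangle. -/
theorem card_layer (i : Fin 3) {σ : ℤ} {x y : ℕ} (hx : σ + 2 = ℓ i + x)
    (hy : (ℓ (i + 1) + ℓ (i + 2) : ℤ) = σ + 1 + y) (hx1 : x ≤ ℓ (i + 1) + 1)
    (hx2 : x ≤ ℓ (i + 2) + 1) (hy1 : y ≤ ℓ (i + 1) + 1) (hy2 : y ≤ ℓ (i + 2) + 1) :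
    2 * (layer ℓ σ).card + x * x + y * y = 2 * (ℓ (i + 1) * ℓ (i + 2)) + x + y := by
  classical
  set q := ℓ (i + 1)
  set r := ℓ (i + 2)
  have h1 : (layer ℓ σ).card =
      ((rect q r).filter fun p : ℤ × ℤ => ¬ (p.1 + p.2 + 1 < x ∨ σ < p.1 + p.2)).card := by
    refine card_eq_card_of_coord i (fun p : ℤ × ℤ => σ - p.1 - p.2) fun t => ?_
    rw [mem_layer, inBox_iff ℓ i, forall_ne_iff, Finset.mem_filter, mem_rect, coordSum_eq t i]
    constructor
    · rintro ⟨⟨⟨h1, h2⟩, h3⟩, h4⟩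
      refine ⟨⟨⟨h1, h2⟩, ?_⟩, ?_⟩ <;> dsimp only <;> omega
    · rintro ⟨⟨⟨h1, h2⟩, h3⟩, h4⟩
      dsimp only at h1 h2 h3 h4
      exact ⟨⟨⟨h1, h2⟩, by omega⟩, by omega⟩
  have h2 := Finset.card_filter_add_card_filter_not (s := rect q r)
    (fun p : ℤ × ℤ => p.1 + p.2 + 1 < x ∨ σ < p.1 + p.2)
  rw [Finset.filter_or, Finset.card_union_of_disjoint (Finset.disjoint_filter.mpr fun p _ h => by
    omega), card_rect, ← h1] at h2
  have h6 := card_filter_reflect (q := q) (r := r) (fun u => σ < u)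
  have h3 := card_triangle hx1 hx2
  have h4 := card_triangle hy1 hy2
  have h5 : ((rect q r).filter fun p : ℤ × ℤ => σ < q + r - 2 - (p.1 + p.2)) =
      (rect q r).filter fun p : ℤ × ℤ => p.1 + p.2 + 1 < y := by
    refine Finset.filter_congr fun p _ => ?_
    omega
  rw [h6, h5] at h2
  linarith

theorem card_side (i : Fin 3) {c σ : ℤ} (h1 : -1 ≤ c) (h2 : c ≤ ℓ i) :
    (side ℓ i c σ).card =
      ((rect (ℓ (i + 1)) (ℓ (i + 2))).filter fun p : ℤ × ℤ => p.1 + p.2 = σ - c).card := by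
  refine card_eq_card_of_coord i (fun _ => c) fun t => ?_
  rw [mem_side ℓ h1 h2, forall_ne_iff, Finset.mem_filter, mem_rect, coordSum_eq t i]
  dsimp only
  constructor
  · rintro ⟨h, h3, h4⟩
    exact ⟨⟨h, by omega⟩, h3⟩
  · rintro ⟨⟨h, h3⟩, h4⟩
    exact ⟨h, h4, by omega⟩

theorem card_low_side (i : Fin 3) {s : ℤ} {y : ℕ}
    (hy : (ℓ (i + 1) + ℓ (i + 2) : ℤ) = s + 2 + y) (hy1 : y ≤ ℓ (i + 1))
    (hy2 : y ≤ ℓ (i + 2)) : (side ℓ i (-1) s).card = y := by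
  classical
  rw [card_side ℓ i le_rfl (by omega)]
  refine (card_filter_reflect fun u => u = s - -1).trans ?_
  refine Eq.trans (congrArg _ (Finset.filter_congr fun p _ => ?_)) (card_diagonal hy1 hy2)
  omega

theorem card_high_side (i : Fin 3) {s : ℤ} {x : ℕ} (hx : s + 2 = ℓ i + x)
    (hx1 : x ≤ ℓ (i + 1)) (hx2 : x ≤ ℓ (i + 2)) : (side ℓ i (ℓ i) (s + 1)).card = x := by
  rw [card_side ℓ i (by omega) le_rfl]
  refine Eq.trans (congrArg _ (Finset.filter_congr fun p _ => ?_)) (card_diagonal hx1 hx2)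
  omega

theorem card_outer {s : ℤ} (h1 : ∀ i, (ℓ i : ℤ) ≤ s + 2)
    (h2 : ∀ i j, i ≠ j → s + 2 ≤ (ℓ i + ℓ j : ℤ)) :
    (outer ℓ s).card = ∑ i, ℓ i := by
  classical
  -- The low side has ℓ(i+1) + ℓ(i+2) - (s + 2) points and the high side s + 2 - ℓ(i); `h1` and `h2`
  -- say that these numbers are not negative. The layer `s` cancels in the sum.
  have hside : ∀ i, ((side ℓ i (-1) s ∪ side ℓ i (ℓ i) (s + 1)).card : ℤ) =
      ℓ (i + 1) + ℓ (i + 2) - ℓ i := by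
    intro i
    obtain ⟨n1, n2, n3⟩ := Fin.three_ne i
    have a1 := h1 i
    have a2 := h1 (i + 1)
    have a3 := h1 (i + 2)
    have b1 := h2 _ _ n1
    have b2 := h2 _ _ n2
    have b3 := h2 _ _ n3
    rw [Finset.card_union_of_disjoint,
      card_low_side ℓ i (y := (ℓ (i + 1) + ℓ (i + 2) - (s + 2)).toNat) (by omega) (by omega)
        (by omega),
      card_high_side ℓ i (x := (s + 2 - ℓ i).toNat) (by omega) (by omega) (by omega)]
    · push_cast
      omega
    · rw [Finset.disjoint_left]
      intro t ht ht'
      rw [mem_side ℓ (by omega) (by omega)] at ht ht'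
      omega
  have hdisj : ∀ i j, i ≠ j → Disjoint (side ℓ i (-1) s ∪ side ℓ i (ℓ i) (s + 1))
      (side ℓ j (-1) s ∪ side ℓ j (ℓ j) (s + 1)) := by
    intro i j hij
    rw [Finset.disjoint_left]
    intro t ht ht'
    rw [Finset.mem_union, mem_side ℓ (by omega) (by omega), mem_side ℓ (by omega) (by omega)]
      at ht ht'
    rcases ht with ht | ht <;> rcases ht' with ht' | ht' <;>
    · have := ht'.1 i hij
      omega
  rw [outer, Finset.card_biUnion fun i _ j _ hij => hdisj i j hij]
  zify
  rw [Fin.sum_univ_three, Fin.sum_univ_three, hside, hside, hside]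
  change ((ℓ 1 : ℤ) + ℓ 2 - ℓ 0) + (ℓ 2 + ℓ 0 - ℓ 1) + (ℓ 0 + ℓ 1 - ℓ 2) = _
  ring

theorem card_inner {s : ℤ} (i : Fin 3) (h1 : ∀ i, (ℓ i : ℤ) ≤ s + 2)
    (h2 : ∀ i j, i ≠ j → s + 2 ≤ (ℓ i + ℓ j : ℤ)) :
    ((inner ℓ s).card : ℤ) = 2 * (ℓ (i + 1) * ℓ (i + 2)) - (s + 2 - ℓ i) ^ 2 -
      (ℓ (i + 1) + ℓ (i + 2) - (s + 2)) ^ 2 := by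
  classical
  obtain ⟨n1, n2, n3⟩ := Fin.three_ne i
  have a1 := h1 i
  have a2 := h1 (i + 1)
  have a3 := h1 (i + 2)
  have b1 := h2 _ _ n1
  have b2 := h2 _ _ n2
  have b3 := h2 _ _ n3
  obtain ⟨x, hx⟩ := Int.eq_ofNat_of_zero_le (sub_nonneg.mpr a1)
  obtain ⟨y, hy⟩ := Int.eq_ofNat_of_zero_le (sub_nonneg.mpr b3)
  rw [inner, Finset.card_union_of_disjoint]
  · have c1 := card_layer ℓ i (σ := s) (x := x) (y := y + 1) (by omega) (by omega) (by omega)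
      (by omega) (by omega) (by omega)
    have c2 := card_layer ℓ i (σ := s + 1) (x := x + 1) (y := y) (by omega) (by omega) (by omega)
      (by omega) (by omega) (by omega)
    have hy' : (ℓ (i + 1) + ℓ (i + 2) - (s + 2) : ℤ) = y := by linarith
    rw [hx, hy']
    zify at c1 c2
    push_cast
    linarith
  · rw [Finset.disjoint_left]
    intro t ht ht'
    rw [mem_layer] at ht ht'
    omega

end HexBox

/-! ### Extremal graphs and the values of `f3` -/

namespace PlaneGraph

/-- The parameter `S` stands for `s + 2`. The applications take nearly equal sides and for `S` half
their sum, rounded up. -/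
theorem mem_vertexCounts_of_box {p q r S v : ℕ} (hp : 0 < p) (hq : 0 < q) (hr : 0 < r)
    (hpS : p ≤ S) (hqS : q ≤ S) (hrS : r ≤ S) (hpq : S ≤ p + q) (hqr : S ≤ q + r)
    (hpr : S ≤ p + r)
    (hv : (v : ℤ) = 2 * (q * r) - (S - p) ^ 2 - (q + r - S) ^ 2) :
    v + (p + q + r) ∈ vertexCounts (p + q + r) := by
  have h1 : ∀ i : Fin 3, ((![p, q, r] i : ℕ) : ℤ) ≤ (S : ℤ) - 2 + 2 := by
    intro i
    fin_cases i <;> simp <;> assumption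
  have h2 : ∀ i j : Fin 3, i ≠ j → (S : ℤ) - 2 + 2 ≤ (![p, q, r] i : ℕ) + (![p, q, r] j : ℕ) := by
    intro i j hij
    fin_cases i <;> fin_cases j <;> first | exact absurd rfl hij | (simp; omega)
  have hc := HexBox.card_inner ![p, q, r] 0 h1 h2
  have ho := HexBox.card_outer ![p, q, r] h1 h2
  have hm := HexBox.card_mem_vertexCounts ![p, q, r] ((S : ℤ) - 2) (by
    intro i
    fin_cases i <;> simp <;> assumption)
  have hc' : ((HexBox.inner ![p, q, r] ((S : ℤ) - 2)).card : ℤ) = v := by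
    rw [hc, hv, sub_add_cancel]
    rfl
  rw [ho, Fin.sum_univ_three] at hm
  rw [Int.natCast_inj] at hc'
  rwa [hc'] at hm

/-- The graph with a single edge, between `a` and `b`. -/
noncomputable def singleEdge {a b : Plane} (h : a ≠ b) : PlaneGraph where
  verts := {a, b}
  graph := SimpleGraph.edge a b
  mem_verts_of_adj u v huv := by
    rw [SimpleGraph.edge_adj] at huv
    rw [Finset.mem_insert, Finset.mem_singleton]
    tauto
  vertex_notMem_edge u v w huv hw := by
    rw [SimpleGraph.edge_adj] at huv
    rw [Finset.mem_insert, Finset.mem_singleton] at hw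
    rcases huv with ⟨⟨rfl, rfl⟩ | ⟨rfl, rfl⟩, -⟩ <;> rcases hw with rfl | rfl <;>
    simp [h, h.symm]
  edges_disjoint u v x y huv hxy hne := by
    rw [SimpleGraph.edge_adj] at huv hxy
    exfalso
    rcases huv with ⟨⟨rfl, rfl⟩ | ⟨rfl, rfl⟩, -⟩ <;>
    rcases hxy with ⟨⟨rfl, rfl⟩ | ⟨rfl, rfl⟩, -⟩ <;>
    first | exact hne rfl | exact hne Sym2.eq_swap

theorem two_mem_vertexCounts : 2 ∈ vertexCounts 2 := by
  have h : (0 : Plane) ≠ EuclideanSpace.single 0 1 := by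
    intro h
    have := congrArg (fun v : Plane => v 0) h
    simp at this
  have hdeg : ∀ v ∈ (singleEdge h).verts, (singleEdge h).degree v = 1 := by
    intro v hv
    have hv' : v = 0 ∨ v = EuclideanSpace.single 0 1 := by
      simpa [singleEdge] using hv
    rw [degree, Finset.card_eq_one]
    rcases hv' with rfl | rfl
    · refine ⟨EuclideanSpace.single 0 1, ?_⟩
      ext w
      rw [mem_neighbors, Finset.mem_singleton]
      simp only [singleEdge, SimpleGraph.edge_adj]
      constructor
      · tauto
      · rintro rfl; simpa using h
    · refine ⟨0, ?_⟩
      ext w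
      rw [mem_neighbors, Finset.mem_singleton]
      simp only [singleEdge, SimpleGraph.edge_adj]
      constructor
      · rintro ⟨⟨h1, -⟩ | ⟨-, h1⟩, -⟩
        · exact absurd h1.symm h
        · exact h1
      · rintro rfl; simp
  refine ⟨singleEdge h, (singleEdge h).verts, ⟨subset_rfl, hdeg, ?_⟩, ?_, ?_, ?_⟩
  · intro v hv hd
    rw [hdeg v hv] at hd
    omega
  · exact fun v hv hA => absurd hv hA
  · exact Finset.card_pair h
  · exact Finset.card_pair h

/-- By parity a larger graph would have at least `v + 2` vertices of degree 3, so falling short of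
n²/6 by less than 2 is good enough. -/
theorem isGreatest_vertexCounts {n v : ℕ} (h : v + n ∈ vertexCounts n)
    (hv : n ^ 2 < 6 * (v + 2)) : IsGreatest (vertexCounts n) (v + n) := by
  refine ⟨h, fun m hm => ?_⟩
  obtain ⟨w, rfl, hw, hpar⟩ := exists_eq_add_of_mem_vertexCounts hm
  obtain ⟨v', hv', -, hpar'⟩ := exists_eq_add_of_mem_vertexCounts h
  obtain rfl : v = v' := by omega
  rw [Nat.even_iff] at hpar hpar'
  omega

theorem f3_eq_of_isGreatest {n m : ℕ} (h : IsGreatest (vertexCounts n) m) : f3 n = m := by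
  refine le_antisymm (iSup₂_le fun k hk => ?_) (le_iSup₂_of_le m h.1 le_rfl)
  exact_mod_cast h.2 hk

theorem isGreatest_six_mul {k : ℕ} (hk : 0 < k) :
    IsGreatest (vertexCounts (6 * k)) (6 * k ^ 2 + 6 * k) := by
  refine isGreatest_vertexCounts ?_ (by nlinarith)
  have := mem_vertexCounts_of_box (p := 2 * k) (q := 2 * k) (r := 2 * k) (S := 3 * k)
    (v := 6 * k ^ 2) (by omega) (by omega) (by omega) (by omega) (by omega) (by omega) (by omega)
    (by omega) (by omega) (by push_cast; ring)
  convert this using 1 <;> ring_nf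

theorem isGreatest_six_mul_add_one {k : ℕ} (hk : 0 < k) :
    IsGreatest (vertexCounts (6 * k + 1)) (6 * k ^ 2 + 8 * k) := by
  -- The number of vertices of degree 3 is 6k² + 2k - 1, one less than the integer part of n²/6,
  -- because it has to be odd. The shift to `j` avoids the subtraction.
  obtain ⟨j, rfl⟩ : ∃ j, k = j + 1 := ⟨k - 1, by omega⟩
  have := mem_vertexCounts_of_box (p := 2 * j + 2) (q := 2 * j + 2) (r := 2 * j + 3)
    (S := 3 * j + 4) (v := 6 * j ^ 2 + 14 * j + 7) (by omega) (by omega) (by omega) (by omega)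
    (by omega) (by omega) (by omega) (by omega) (by omega) (by push_cast; ring)
  have h := isGreatest_vertexCounts this (by nlinarith)
  convert h using 1 <;> ring_nf

theorem isGreatest_six_mul_add_two (k : ℕ) :
    IsGreatest (vertexCounts (6 * k + 2)) (6 * k ^ 2 + 10 * k + 2) := by
  -- For `k = 0` the box below would have a side of length 0; a single edge takes its place.
  rcases Nat.eq_zero_or_pos k with rfl | hk
  · exact isGreatest_vertexCounts (v := 0) two_mem_vertexCounts (by norm_num)
  have := mem_vertexCounts_of_box (p := 2 * k) (q := 2 * k + 1) (r := 2 * k + 1)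
    (S := 3 * k + 1) (v := 6 * k ^ 2 + 4 * k) (by omega) (by omega) (by omega) (by omega)
    (by omega) (by omega) (by omega) (by omega) (by omega) (by push_cast; ring)
  have h := isGreatest_vertexCounts this (by nlinarith)
  convert h using 1 <;> ring_nf

theorem isGreatest_six_mul_add_three (k : ℕ) :
    IsGreatest (vertexCounts (6 * k + 3)) (6 * k ^ 2 + 12 * k + 4) := by
  have := mem_vertexCounts_of_box (p := 2 * k + 1) (q := 2 * k + 1) (r := 2 * k + 1)
    (S := 3 * k + 2) (v := 6 * k ^ 2 + 6 * k + 1) (by omega) (by omega) (by omega) (by omega)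
    (by omega) (by omega) (by omega) (by omega) (by omega) (by push_cast; ring)
  have h := isGreatest_vertexCounts this (by nlinarith)
  convert h using 1 <;> ring_nf

theorem isGreatest_six_mul_add_four (k : ℕ) :
    IsGreatest (vertexCounts (6 * k + 4)) (6 * k ^ 2 + 14 * k + 6) := by
  have := mem_vertexCounts_of_box (p := 2 * k + 1) (q := 2 * k + 1) (r := 2 * k + 2)
    (S := 3 * k + 2) (v := 6 * k ^ 2 + 8 * k + 2) (by omega) (by omega) (by omega) (by omega)
    (by omega) (by omega) (by omega) (by omega) (by omega) (by push_cast; ring)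
  have h := isGreatest_vertexCounts this (by nlinarith)
  convert h using 1 <;> ring_nf

theorem isGreatest_six_mul_add_five (k : ℕ) :
    IsGreatest (vertexCounts (6 * k + 5)) (6 * k ^ 2 + 16 * k + 8) := by
  have := mem_vertexCounts_of_box (p := 2 * k + 1) (q := 2 * k + 2) (r := 2 * k + 2)
    (S := 3 * k + 3) (v := 6 * k ^ 2 + 10 * k + 3) (by omega) (by omega) (by omega) (by omega)
    (by omega) (by omega) (by omega) (by omega) (by omega) (by push_cast; ring)
  have h := isGreatest_vertexCounts this (by nlinarith)
  convert h using 1 <;> ring_nf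

theorem exists_isGreatest_vertexCounts {n : ℕ} (hn : 2 ≤ n) :
    ∃ m, IsGreatest (vertexCounts n) m := by
  obtain ⟨k, i, hi, rfl⟩ : ∃ k i, i < 6 ∧ n = 6 * k + i :=
    ⟨n / 6, n % 6, Nat.mod_lt _ (by norm_num), by omega⟩
  interval_cases i
  · exact ⟨_, isGreatest_six_mul (by omega)⟩
  · exact ⟨_, isGreatest_six_mul_add_one (by omega)⟩
  · exact ⟨_, isGreatest_six_mul_add_two k⟩
  · exact ⟨_, isGreatest_six_mul_add_three k⟩
  · exact ⟨_, isGreatest_six_mul_add_four k⟩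
  · exact ⟨_, isGreatest_six_mul_add_five k⟩

end PlaneGraph

theorem theorem1p1 (n : ℕ) (hn : 2 ≤ n) :
    (∀ k : ℕ, n = 6 * k → PlaneGraph.f3 n = ((6 * k ^ 2 + 6 * k : ℕ) : ℕ∞)) ∧
    (∀ k : ℕ, n = 6 * k + 1 → PlaneGraph.f3 n = ((6 * k ^ 2 + 8 * k : ℕ) : ℕ∞)) ∧
    (∀ k : ℕ, n = 6 * k + 2 → PlaneGraph.f3 n = ((6 * k ^ 2 + 10 * k + 2 : ℕ) : ℕ∞)) ∧
    (∀ k : ℕ, n = 6 * k + 3 → PlaneGraph.f3 n = ((6 * k ^ 2 + 12 * k + 4 : ℕ) : ℕ∞)) ∧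
    (∀ k : ℕ, n = 6 * k + 4 → PlaneGraph.f3 n = ((6 * k ^ 2 + 14 * k + 6 : ℕ) : ℕ∞)) ∧
    (∀ k : ℕ, n = 6 * k + 5 → PlaneGraph.f3 n = ((6 * k ^ 2 + 16 * k + 8 : ℕ) : ℕ∞)) ∧
    (∃ m : ℕ, IsGreatest (PlaneGraph.vertexCounts n) m ∧ PlaneGraph.f3 n = (m : ℕ∞) ∧
      (m : ℝ) ≤ (n : ℝ) ^ 2 / 6 + (n : ℝ)) := by
  refine ⟨?_, ?_, ?_, ?_, ?_, ?_, ?_⟩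
  · rintro k rfl
    exact PlaneGraph.f3_eq_of_isGreatest (PlaneGraph.isGreatest_six_mul (by omega))
  · rintro k rfl
    exact PlaneGraph.f3_eq_of_isGreatest (PlaneGraph.isGreatest_six_mul_add_one (by omega))
  · rintro k rfl
    exact PlaneGraph.f3_eq_of_isGreatest (PlaneGraph.isGreatest_six_mul_add_two k)
  · rintro k rfl
    exact PlaneGraph.f3_eq_of_isGreatest (PlaneGraph.isGreatest_six_mul_add_three k)
  · rintro k rfl
    exact PlaneGraph.f3_eq_of_isGreatest (PlaneGraph.isGreatest_six_mul_add_four k)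
  · rintro k rfl
    exact PlaneGraph.f3_eq_of_isGreatest (PlaneGraph.isGreatest_six_mul_add_five k)
  · obtain ⟨m, hm⟩ := PlaneGraph.exists_isGreatest_vertexCounts hn
    refine ⟨m, hm, PlaneGraph.f3_eq_of_isGreatest hm, ?_⟩
    obtain ⟨v, rfl, hv, -⟩ := PlaneGraph.exists_eq_add_of_mem_vertexCounts hm.1
    have : (6 * v : ℝ) ≤ (n : ℝ) ^ 2 := by exact_mod_cast hv
    push_cast
    linarith
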